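/- Consider the class of partial differential equations for a real function $u=u(t,x)$ $$u_t+\alpha(t)\,u^n u_x+\beta(t)\,u_{xxx}+\sigma(t)\,u_{xxxxx}=0,$$ where $n$ is a nonzero integer and $\alpha,\beta,\sigma$ are smooth nowhere vanishing real functions of $t$ on an open interval $I\subseteq\mathbb{R}$ (if $n<0$, the equation is considered where $u\neq0$). An equation of this class is said to be reducible to a constant-coefficient equation of the class if there are an equation $\tilde u_{\tilde t}+\tilde\alpha\,\tilde u^{\tilde n}\tilde u_{\tilde x}+\tilde\beta\,\tilde u_{\tilde x\tilde x\tilde x}+\tilde\sigma\,\tilde u_{\tilde x\tilde x\tilde x\tilde x\tilde x}=0$ with $\tilde n$ a nonzero integer and $\tilde\alpha,\tilde\beta,\tilde\sigma$ nonzero constants, and a smooth invertible point transformation $(\tilde t,\tilde x,\tilde u)=\Phi(t,x,u)$ with nonvanishing Jacobian, defined on an open set of points $(t,x,u)$ whose projection to the $t$-axis is $I$ (and taking values, and defined, where the respective equations are defined), whose prolongation to fifth-order jets identifies the manifold defined by the first equation in the jet space with the one defined by the second: whenever $\Phi$ maps the graph of a smooth function $u$ near a point onto the graph of a smooth function $\tilde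 u$, $u$ satisfies the first equation at that point if and only if $\tilde u$ satisfies the second equation at the image point. Then an equation of the class is reducible to a constant-coefficient equation of the class if and only if its coefficients satisfy, on $I$, $$\left(\frac{\beta}{\alpha}\right)_t=\left(\frac{\sigma}{\alpha}\right)_t=0\qquad\text{when } n\neq1,$$ $$\left(\frac1\alpha\left(\frac\beta\alpha\right)_t\right)_t=0,\qquad\left(\frac{\sigma\alpha^2}{\beta^3}\right)_t=0\qquad\text{when } n=1.$$ -/

import Mathlib

open scoped ContDiff Topology

/-- A generalized Kawahara equation with time-dependent coefficients,
`u_t + α(t) u^n u_x + β(t) u_xxx + σ(t) u_xxxxx = 0`, where `n` is a nonzero integer and `α`, `β`,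
`σ` are smooth nonvanishing real functions of the time `t`, which runs over an open interval. -/
structure KawaharaEq where
  /-- the exponent of the nonlinearity -/
  n : ℤ
  /-- the time interval (possibly unbounded) -/
  I : Set ℝ
  α : ℝ → ℝ
  β : ℝ → ℝ
  σ : ℝ → ℝ
  n_ne_zero : n ≠ 0
  isOpen_I : IsOpen I
  ordConnected_I : I.OrdConnected
  α_smooth : ContDiffOn ℝ ∞ α I
  β_smooth : ContDiffOn ℝ ∞ β I
  σ_smooth : ContDiffOn ℝ ∞ σ I
  α_ne_zero : ∀ t ∈ I, α t ≠ 0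
  β_ne_zero : ∀ t ∈ I, β t ≠ 0
  σ_ne_zero : ∀ t ∈ I, σ t ≠ 0

namespace KawaharaEq

/-- The points `(t, x, u)` at which the equation is defined: `t` lies in the time interval and,
if the exponent is negative, `u ≠ 0`. -/
def domain (E : KawaharaEq) : Set (ℝ × ℝ × ℝ) :=
  {p | p.1 ∈ E.I ∧ (E.n < 0 → p.2.2 ≠ 0)}

/-- The function `u = u(t, x)` satisfies the equation at the point `(t, x)`. For smooth `u` this
says that the fifth-order jet of `u` at `(t, x)` lies on the manifold defined by the equation. -/
def HoldsAt (E : KawaharaEq) (u : ℝ → ℝ → ℝ) (t x : ℝ) : Prop :=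
  deriv (fun s => u s x) t
    + E.α t * u t x ^ E.n * deriv (fun y => u t y) x
    + E.β t * iteratedDeriv 3 (fun y => u t y) x
    + E.σ t * iteratedDeriv 5 (fun y => u t y) x = 0

/-- All three coefficients are constant on the time interval. -/
def HasConstantCoefficients (E : KawaharaEq) : Prop :=
  ∃ a b c : ℝ, ∀ t ∈ E.I, E.α t = a ∧ E.β t = b ∧ E.σ t = c

end KawaharaEq

/-- `Φ` is a nondegenerate point transformation `(t, x, u) ↦ (t', x', u')` on the open set `Ω`:
smooth, injective, with nonvanishing Jacobian. -/
structure IsPointTransformation (Φ : ℝ × ℝ × ℝ → ℝ × ℝ × ℝ) (Ω : Set (ℝ × ℝ × ℝ)) : Prop where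
  isOpen : IsOpen Ω
  smooth : ContDiffOn ℝ ∞ Φ Ω
  injOn : Set.InjOn Φ Ω
  jacobian_ne_zero : ∀ p ∈ Ω, (fderiv ℝ Φ p).det ≠ 0

/-- Near the point of the graph of `u` above `(t, x)`, the map `Φ` carries the graph of `u` into
the graph of `v`; that is, `v` is locally the transform of `u` under `Φ`. -/
def TransformsGraphNear (Φ : ℝ × ℝ × ℝ → ℝ × ℝ × ℝ) (u v : ℝ → ℝ → ℝ) (t x : ℝ) : Prop :=
  ∀ᶠ q : ℝ × ℝ in 𝓝 (t, x),
    v (Φ (q.1, q.2, u q.1 q.2)).1 (Φ (q.1, q.2, u q.1 q.2)).2.1 = (Φ (q.1, q.2, u q.1 q.2)).2.2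

namespace KawaharaEq

/-- The point transformation `Φ`, defined on the open set `Ω` of the space of variables `(t, x, u)`,
maps the equation `E` to the equation `E'`. The set `Ω` meets every time slice of `E`, and the
prolongation of `Φ` to fifth-order jets identifies the manifold of `E` with that of `E'`: whenever
`Φ` transforms the germ of a smooth function `u` into the germ of a smooth function `v`, `u`
satisfies `E` at the base point if and only if `v` satisfies `E'` at the image base point.
Here `u` is not assumed to be a solution near the point: every jet is tested. -/
structure IsMappedBy (E E' : KawaharaEq) (Φ : ℝ × ℝ × ℝ → ℝ × ℝ × ℝ)
    (Ω : Set (ℝ × ℝ × ℝ)) : Prop where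
  isPointTransformation : IsPointTransformation Φ Ω
  subset_domain : Ω ⊆ E.domain
  mapsTo_domain : Set.MapsTo Φ Ω E'.domain
  covers_time : ∀ t ∈ E.I, ∃ x u : ℝ, (t, x, u) ∈ Ω
  holdsAt_iff : ∀ (u v : ℝ → ℝ → ℝ) (t x : ℝ), (t, x, u t x) ∈ Ω →
    ContDiffAt ℝ ∞ (fun q : ℝ × ℝ => u q.1 q.2) (t, x) →
    ContDiffAt ℝ ∞ (fun q : ℝ × ℝ => v q.1 q.2)
      ((Φ (t, x, u t x)).1, (Φ (t, x, u t x)).2.1) →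
    TransformsGraphNear Φ u v t x →
    (E.HoldsAt u t x ↔ E'.HoldsAt v (Φ (t, x, u t x)).1 (Φ (t, x, u t x)).2.1)

/-- The equation can be mapped by a point transformation to an equation of the class (with an
exponent and a time interval that are not prescribed) whose coefficients are constant. -/
def ReducibleToConstantCoefficients (E : KawaharaEq) : Prop :=
  ∃ E' : KawaharaEq, E'.HasConstantCoefficients ∧
    ∃ (Φ : ℝ × ℝ × ℝ → ℝ × ℝ × ℝ) (Ω : Set (ℝ × ℝ × ℝ)), E.IsMappedBy E' Φ Ω

end KawaharaEq

open Filter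

/-- The order and the leading coefficient of vanishing of a smooth function at `0` determine its
first derivatives at `0`. -/
theorem iteratedDeriv_of_tendsto_div_pow {w : ℝ → ℝ} (hw : ContDiffAt ℝ ∞ w 0) {k : ℕ} {l : ℝ}
    (h : Tendsto (fun s => w s / s ^ k) (𝓝[≠] 0) (𝓝 l)) :
    (∀ j < k, iteratedDeriv j w 0 = 0) ∧ iteratedDeriv k w 0 = k.factorial * l := by
  have key : ∀ j ≤ k, iteratedDeriv j w 0 / j.factorial = l * (0 : ℝ) ^ (k - j) := by
    intro j
    induction j using Nat.strong_induction_on with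
    | _ j ih =>
      intro hj
      have hlow : ∀ i < j, iteratedDeriv i w 0 = 0 := by
        intro i hi
        have := ih i hi (by omega)
        rw [zero_pow (by omega), mul_zero, div_eq_zero_iff] at this
        rcases this with h0 | h0
        · exact h0
        · exact absurd h0 (by positivity)
      obtain ⟨U, hU, hwU⟩ := (hw.of_le (m := (j : ℕ∞ω)) (by exact_mod_cast le_top)).contDiffOn
        le_rfl (by simp)
      obtain ⟨ε, hε, hball⟩ := Metric.mem_nhds_iff.1 (by simpa using hU)
      have hwB := hwU.mono hball
      have ht := Real.taylor_tendsto (convex_ball (0 : ℝ) ε) (Metric.mem_ball_self hε) hwB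
      rw [Metric.isOpen_ball.nhdsWithin_eq (Metric.mem_ball_self hε)] at ht
      have hle : 𝓝[≠] (0 : ℝ) ≤ 𝓝 0 := nhdsWithin_le_nhds
      have ht' := ht.mono_left hle
      have e1 : (fun s => (w s - taylorWithinEval w j (Metric.ball 0 ε) 0 s) / (s - 0) ^ j)
          =ᶠ[𝓝[≠] 0] fun s => w s / s ^ k * s ^ (k - j) - iteratedDeriv j w 0 / j.factorial := by
        filter_upwards [self_mem_nhdsWithin] with s hs
        have hs : s ≠ 0 := hs
        rw [taylor_within_apply, Finset.sum_range_succ, Finset.sum_eq_zero]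
        · rw [iteratedDerivWithin_of_isOpen Metric.isOpen_ball (Metric.mem_ball_self hε)]
          have : s ^ k = s ^ j * s ^ (k - j) := by rw [← pow_add]; congr 1; omega
          rw [this]
          simp only [sub_zero, smul_eq_mul, zero_add]
          field_simp
        · intro i hi
          rw [iteratedDerivWithin_of_isOpen Metric.isOpen_ball (Metric.mem_ball_self hε),
            hlow i (Finset.mem_range.1 hi), smul_zero]
      have h1 := ht'.congr' e1
      have h2 : Tendsto (fun s : ℝ => w s / s ^ k * s ^ (k - j) - iteratedDeriv j w 0 / j.factorial)
          (𝓝[≠] 0) (𝓝 (l * 0 ^ (k - j) - iteratedDeriv j w 0 / j.factorial)) := by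
        refine (h.mul ?_).sub_const _
        exact ((continuous_pow (k - j)).tendsto 0).mono_left hle
      have := tendsto_nhds_unique h1 h2
      linarith
  refine ⟨fun j hj => ?_, ?_⟩
  · have := key j hj.le
    rw [zero_pow (by omega), mul_zero, div_eq_zero_iff] at this
    rcases this with h0 | h0
    · exact h0
    · exact absurd h0 (by positivity)
  · have := key k le_rfl
    have hk : (k.factorial : ℝ) ≠ 0 := by positivity
    rw [div_eq_iff hk] at this
    simp at this
    linarith

/-- Derivatives along an affine change of the variable. -/
theorem iteratedDeriv_of_eventuallyEq_comp_affine {f g : ℝ → ℝ} {c d x : ℝ}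
    (h : ∀ᶠ y in 𝓝 x, g (c * y + d) = f y) (k : ℕ) :
    c ^ k * iteratedDeriv k g (c * x + d) = iteratedDeriv k f x := by
  suffices H : ∀ᶠ y in 𝓝 x, c ^ k * iteratedDeriv k g (c * y + d) = iteratedDeriv k f y from
    H.self_of_nhds
  induction k with
  | zero => simpa using h
  | succ k ih =>
    filter_upwards [ih.eventually_nhds] with y hy
    have h1 : (fun y => c ^ k * iteratedDeriv k g (c * y + d)) =ᶠ[𝓝 y] iteratedDeriv k f := hy
    rw [iteratedDeriv_succ, iteratedDeriv_succ, ← h1.deriv_eq]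
    have h2 := deriv_comp_mul_left c (fun y => iteratedDeriv k g (y + d)) y
    rw [deriv_const_mul_field, h2, smul_eq_mul, deriv_comp_add_const]
    ring

/-- The functions `1`, `w`, `w ^ n` are linearly independent near each point if `n ≠ 0, 1`. -/
theorem eq_zero_of_eventually_affine_add_zpow {A B C w₀ : ℝ} {n : ℤ} (h0 : n ≠ 0) (h1 : n ≠ 1)
    (h : ∀ᶠ w in 𝓝 w₀, A + B * w + C * w ^ n = 0) : A = 0 ∧ B = 0 ∧ C = 0 := by
  obtain ⟨w, hw, hw0⟩ : ∃ w, (∀ᶠ y in 𝓝 w, A + B * y + C * y ^ n = 0) ∧ w ≠ 0 := by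
    have h2 : ∀ᶠ w in 𝓝[≠] w₀, (∀ᶠ y in 𝓝 w, A + B * y + C * y ^ n = 0) :=
      h.eventually_nhds.filter_mono nhdsWithin_le_nhds
    have h3 : ∀ᶠ w in 𝓝[≠] w₀, w ≠ 0 := by
      rcases eq_or_ne w₀ 0 with rfl | h'
      · exact self_mem_nhdsWithin
      · exact (eventually_ne_nhds h').filter_mono nhdsWithin_le_nhds
    exact (h2.and h3).exists
  have d1 : ∀ᶠ y in 𝓝 w, B + C * (n * y ^ (n - 1)) = 0 := by
    filter_upwards [hw.eventually_nhds, eventually_ne_nhds hw0] with y hy hy0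
    have e : (fun y => A + B * y + C * y ^ n) =ᶠ[𝓝 y] fun _ => 0 := hy
    have e1 := e.deriv_eq
    have e2 : HasDerivAt (fun y => A + B * y + C * y ^ n) (B * 1 + C * (n * y ^ (n - 1))) y :=
      (((hasDerivAt_id y).const_mul B).const_add A).add
        ((hasDerivAt_zpow n y (Or.inl hy0)).const_mul C)
    rw [e2.deriv] at e1
    simpa using e1
  have d2 : C * (n * ((n - 1 : ℤ) * w ^ (n - 1 - 1))) = 0 := by
    have e : (fun y => B + C * (n * y ^ (n - 1))) =ᶠ[𝓝 w] fun _ => 0 := d1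
    have e1 := e.deriv_eq
    have e2 : HasDerivAt (fun y => B + C * (n * y ^ (n - 1)))
        (C * (n * ((n - 1 : ℤ) * w ^ (n - 1 - 1)))) w :=
      (((hasDerivAt_zpow (n - 1) w (Or.inl hw0)).const_mul (n : ℝ)).const_mul C).const_add B
    rw [e2.deriv] at e1
    simpa using e1
  have hC : C = 0 := by
    have hn0 : (n : ℝ) ≠ 0 := by exact_mod_cast h0
    have hn1 : (n : ℝ) - 1 ≠ 0 := sub_ne_zero.2 (by exact_mod_cast h1)
    have := zpow_ne_zero (n - 1 - 1) hw0
    simpa [hn0, hn1, this] using d2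
  have hB : B = 0 := by simpa [hC] using d1.self_of_nhds
  have hA : A = 0 := by simpa [hC, hB] using hw.self_of_nhds
  exact ⟨hA, hB, hC⟩

/-- A polynomial function of `(t, x)` with a prescribed jet at `(t₀, x₀)`. -/
def jetFunction (t₀ x₀ z a b c₃ c₄ c₅ e : ℝ) (t x : ℝ) : ℝ :=
  z + a * (t - t₀) + b * (x - x₀) + c₃ * (x - x₀) ^ 3 + c₄ * (x - x₀) ^ 4 + c₅ * (x - x₀) ^ 5
    + e * (t - t₀) ^ 5

section jetFunction

variable (t₀ x₀ z a b c₃ c₄ c₅ e : ℝ)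

@[simp] theorem jetFunction_self : jetFunction t₀ x₀ z a b c₃ c₄ c₅ e t₀ x₀ = z := by
  simp [jetFunction]

theorem contDiff_jetFunction :
    ContDiff ℝ ∞ (fun q : ℝ × ℝ => jetFunction t₀ x₀ z a b c₃ c₄ c₅ e q.1 q.2) := by
  unfold jetFunction
  fun_prop

theorem deriv_jetFunction_time :
    deriv (fun s => jetFunction t₀ x₀ z a b c₃ c₄ c₅ e s x₀) t₀ = a := by
  have h1 : HasDerivAt (fun s => s - t₀) 1 t₀ := (hasDerivAt_id t₀).sub_const t₀
  have h := (((h1.const_mul a).const_add z).add ((h1.pow 5).const_mul e))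
  have e0 : (fun s => jetFunction t₀ x₀ z a b c₃ c₄ c₅ e s x₀)
      = fun s => z + a * (s - t₀) + e * (s - t₀) ^ 5 := by
    funext s; simp [jetFunction]
  rw [e0]
  refine h.deriv.trans ?_
  simp

theorem hasDerivAt_quintic (c₀ c₁ c₂ c₃ c₄ c₅ x₀ x : ℝ) :
    HasDerivAt (fun y => c₀ + c₁ * (y - x₀) + c₂ * (y - x₀) ^ 2 + c₃ * (y - x₀) ^ 3
      + c₄ * (y - x₀) ^ 4 + c₅ * (y - x₀) ^ 5)
      (c₁ + (2 * c₂) * (x - x₀) + (3 * c₃) * (x - x₀) ^ 2 + (4 * c₄) * (x - x₀) ^ 3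
      + (5 * c₅) * (x - x₀) ^ 4 + 0 * (x - x₀) ^ 5) x := by
  have h1 : HasDerivAt (fun s => s - x₀) 1 x := (hasDerivAt_id x).sub_const x₀
  have h := (((((h1.const_mul c₁).const_add c₀).add ((h1.pow 2).const_mul c₂)).add
    ((h1.pow 3).const_mul c₃)).add ((h1.pow 4).const_mul c₄)).add ((h1.pow 5).const_mul c₅)
  refine h.congr_deriv ?_
  norm_num
  ring

theorem deriv_quintic (c₀ c₁ c₂ c₃ c₄ c₅ x₀ : ℝ) :
    deriv (fun y => c₀ + c₁ * (y - x₀) + c₂ * (y - x₀) ^ 2 + c₃ * (y - x₀) ^ 3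
      + c₄ * (y - x₀) ^ 4 + c₅ * (y - x₀) ^ 5) =
    fun y => c₁ + (2 * c₂) * (y - x₀) + (3 * c₃) * (y - x₀) ^ 2 + (4 * c₄) * (y - x₀) ^ 3
      + (5 * c₅) * (y - x₀) ^ 4 + 0 * (y - x₀) ^ 5 :=
  funext fun x => (hasDerivAt_quintic c₀ c₁ c₂ c₃ c₄ c₅ x₀ x).deriv

theorem jetFunction_base_eq : (fun y => jetFunction t₀ x₀ z a b c₃ c₄ c₅ e t₀ y) =
    fun y => z + b * (y - x₀) + 0 * (y - x₀) ^ 2 + c₃ * (y - x₀) ^ 3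
      + c₄ * (y - x₀) ^ 4 + c₅ * (y - x₀) ^ 5 := by
  funext y; simp [jetFunction]

theorem deriv_jetFunction_space :
    deriv (fun y => jetFunction t₀ x₀ z a b c₃ c₄ c₅ e t₀ y) x₀ = b := by
  rw [jetFunction_base_eq, deriv_quintic]; simp

theorem iteratedDeriv_three_jetFunction :
    iteratedDeriv 3 (fun y => jetFunction t₀ x₀ z a b c₃ c₄ c₅ e t₀ y) x₀ = 6 * c₃ := by
  rw [jetFunction_base_eq]
  simp only [iteratedDeriv_eq_iterate, Function.iterate_succ, Function.iterate_zero,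
    Function.comp_apply, id, deriv_quintic]
  simp; ring

theorem iteratedDeriv_five_jetFunction :
    iteratedDeriv 5 (fun y => jetFunction t₀ x₀ z a b c₃ c₄ c₅ e t₀ y) x₀ = 120 * c₅ := by
  rw [jetFunction_base_eq]
  simp only [iteratedDeriv_eq_iterate, Function.iterate_succ, Function.iterate_zero,
    Function.comp_apply, id, deriv_quintic]
  simp; ring

theorem hasFDerivAt_jetFunction :
    HasFDerivAt (fun q : ℝ × ℝ => jetFunction t₀ x₀ z a b c₃ c₄ c₅ e q.1 q.2)
      (a • ContinuousLinearMap.fst ℝ ℝ ℝ + b • ContinuousLinearMap.snd ℝ ℝ ℝ) (t₀, x₀) := by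
  have hd := ((contDiff_jetFunction t₀ x₀ z a b c₃ c₄ c₅ e).differentiable (by simp)
    (t₀, x₀)).hasFDerivAt
  refine hd.congr_fderiv ?_
  have ht : HasDerivAt (fun s : ℝ => ((s, x₀) : ℝ × ℝ)) (1, 0) t₀ :=
    (hasDerivAt_id t₀).prodMk (hasDerivAt_const t₀ x₀)
  have hx : HasDerivAt (fun y : ℝ => ((t₀, y) : ℝ × ℝ)) (0, 1) x₀ :=
    (hasDerivAt_const x₀ t₀).prodMk (hasDerivAt_id x₀)
  have h1 := (hd.comp_hasDerivAt t₀ ht).deriv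
  have h2 := (hd.comp_hasDerivAt x₀ hx).deriv
  have h1' := deriv_jetFunction_time t₀ x₀ z a b c₃ c₄ c₅ e
  have h2' := deriv_jetFunction_space t₀ x₀ z a b c₃ c₄ c₅ e
  ext
  · simp; exact h1.symm.trans h1'
  · simp; exact h2.symm.trans h2'

theorem KawaharaEq.holdsAt_jetFunction_iff (E : KawaharaEq) :
    E.HoldsAt (jetFunction t₀ x₀ z a b c₃ c₄ c₅ e) t₀ x₀ ↔
      a + E.α t₀ * z ^ E.n * b + 6 * E.β t₀ * c₃ + 120 * E.σ t₀ * c₅ = 0 := by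
  unfold KawaharaEq.HoldsAt
  rw [deriv_jetFunction_time, deriv_jetFunction_space, iteratedDeriv_three_jetFunction,
    iteratedDeriv_five_jetFunction, jetFunction_self]
  constructor <;> intro h <;> linarith

end jetFunction

section partials

variable (Φ : ℝ × ℝ × ℝ → ℝ × ℝ × ℝ) (p : ℝ × ℝ × ℝ)

/-- The partial derivative with respect to `t`. -/
noncomputable def partialT : ℝ × ℝ × ℝ := fderiv ℝ Φ p (1, 0, 0)

/-- The partial derivative with respect to `x`. -/
noncomputable def partialX : ℝ × ℝ × ℝ := fderiv ℝ Φ p (0, 1, 0)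

/-- The partial derivative with respect to `u`. -/
noncomputable def partialU : ℝ × ℝ × ℝ := fderiv ℝ Φ p (0, 0, 1)

theorem fderiv_apply_eq_partials (r s w : ℝ) :
    fderiv ℝ Φ p (r, s, w) = r • partialT Φ p + s • partialX Φ p + w • partialU Φ p := by
  unfold partialT partialX partialU
  rw [← map_smul, ← map_smul, ← map_smul, ← map_add, ← map_add]
  simp

end partials

section transform

variable {Φ : ℝ × ℝ × ℝ → ℝ × ℝ × ℝ} {Ω : Set (ℝ × ℝ × ℝ)}

theorem IsPointTransformation.contDiffAt (h : IsPointTransformation Φ Ω) {p : ℝ × ℝ × ℝ}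
    (hp : p ∈ Ω) : ContDiffAt ℝ ∞ Φ p :=
  h.smooth.contDiffAt (h.isOpen.mem_nhds hp)

theorem IsPointTransformation.hasFDerivAt (h : IsPointTransformation Φ Ω) {p : ℝ × ℝ × ℝ}
    (hp : p ∈ Ω) : HasFDerivAt Φ (fderiv ℝ Φ p) p :=
  ((h.contDiffAt hp).differentiableAt (by simp)).hasFDerivAt

/-- The Jacobi matrix of a point transformation has full rank. -/
theorem IsPointTransformation.exists_combination (h : IsPointTransformation Φ Ω) {p : ℝ × ℝ × ℝ}
    (hp : p ∈ Ω) (w : ℝ × ℝ × ℝ) :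
    ∃ r s m : ℝ, r • partialT Φ p + s • partialX Φ p + m • partialU Φ p = w := by
  let e := (fderiv ℝ Φ p).toContinuousLinearEquivOfDetNeZero (h.jacobian_ne_zero p hp)
  refine ⟨(e.symm w).1, (e.symm w).2.1, (e.symm w).2.2, ?_⟩
  rw [← fderiv_apply_eq_partials]
  exact e.apply_symm_apply w

theorem HasFDerivAt.comp_graph {u : ℝ → ℝ → ℝ} {t x a b : ℝ} {Φ' : ℝ × ℝ × ℝ →L[ℝ] ℝ × ℝ × ℝ}
    (hΦ : HasFDerivAt Φ Φ' (t, x, u t x))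
    (hu : HasFDerivAt (fun q : ℝ × ℝ => u q.1 q.2)
      (a • ContinuousLinearMap.fst ℝ ℝ ℝ + b • ContinuousLinearMap.snd ℝ ℝ ℝ) (t, x)) :
    HasFDerivAt (fun q : ℝ × ℝ => Φ (q.1, q.2, u q.1 q.2))
      (Φ'.comp ((ContinuousLinearMap.fst ℝ ℝ ℝ).prod ((ContinuousLinearMap.snd ℝ ℝ ℝ).prod
        (a • ContinuousLinearMap.fst ℝ ℝ ℝ + b • ContinuousLinearMap.snd ℝ ℝ ℝ)))) (t, x) := by
  have h1 : HasFDerivAt (fun q : ℝ × ℝ => ((q.1, q.2, u q.1 q.2) : ℝ × ℝ × ℝ))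
      ((ContinuousLinearMap.fst ℝ ℝ ℝ).prod ((ContinuousLinearMap.snd ℝ ℝ ℝ).prod
        (a • ContinuousLinearMap.fst ℝ ℝ ℝ + b • ContinuousLinearMap.snd ℝ ℝ ℝ))) (t, x) :=
    hasFDerivAt_fst.prodMk (hasFDerivAt_snd.prodMk hu)
  exact HasFDerivAt.comp (t, x) (f := fun q : ℝ × ℝ => ((q.1, q.2, u q.1 q.2) : ℝ × ℝ × ℝ)) hΦ h1

theorem HasFDerivAt.eq_fst_snd {v : ℝ → ℝ → ℝ} {t x : ℝ} {v' : ℝ × ℝ →L[ℝ] ℝ}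
    (h : HasFDerivAt (fun q : ℝ × ℝ => v q.1 q.2) v' (t, x)) :
    v' = deriv (fun s => v s x) t • ContinuousLinearMap.fst ℝ ℝ ℝ
      + deriv (fun y => v t y) x • ContinuousLinearMap.snd ℝ ℝ ℝ := by
  have ht : HasDerivAt (fun s : ℝ => ((s, x) : ℝ × ℝ)) (1, 0) t :=
    (hasDerivAt_id t).prodMk (hasDerivAt_const t x)
  have hx : HasDerivAt (fun y : ℝ => ((t, y) : ℝ × ℝ)) (0, 1) x :=
    (hasDerivAt_const x t).prodMk (hasDerivAt_id x)
  have h1 : deriv (fun s => v s x) t = v' (1, 0) :=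
    (HasFDerivAt.comp_hasDerivAt (l := fun q : ℝ × ℝ => v q.1 q.2) t h ht).deriv
  have h2 : deriv (fun y => v t y) x = v' (0, 1) :=
    (HasFDerivAt.comp_hasDerivAt (l := fun q : ℝ × ℝ => v q.1 q.2) x h hx).deriv
  ext
  · simp [h1]
  · simp [h2]

/-- The first prolongation of a point transformation. -/
theorem TransformsGraphNear.first_order {u v : ℝ → ℝ → ℝ} {t x z a b : ℝ}
    (h : TransformsGraphNear Φ u v t x) (hz : u t x = z) (hΦ : DifferentiableAt ℝ Φ (t, x, z))
    (hu : HasFDerivAt (fun q : ℝ × ℝ => u q.1 q.2)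
      (a • ContinuousLinearMap.fst ℝ ℝ ℝ + b • ContinuousLinearMap.snd ℝ ℝ ℝ) (t, x))
    (hv : ContDiffAt ℝ ∞ (fun q : ℝ × ℝ => v q.1 q.2)
      ((Φ (t, x, z)).1, (Φ (t, x, z)).2.1)) :
    let vT := deriv (fun s => v s (Φ (t, x, z)).2.1) (Φ (t, x, z)).1
    let vX := deriv (fun y => v (Φ (t, x, z)).1 y) (Φ (t, x, z)).2.1
    let A := partialT Φ (t, x, z) + a • partialU Φ (t, x, z)
    let B := partialX Φ (t, x, z) + b • partialU Φ (t, x, z)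
    vT * A.1 + vX * A.2.1 = A.2.2 ∧ vT * B.1 + vX * B.2.1 = B.2.2 := by
  subst hz
  intro vT vX A B
  have hg := HasFDerivAt.comp_graph hΦ.hasFDerivAt hu
  have hv' := (hv.differentiableAt (by simp)).hasFDerivAt
  rw [hv'.eq_fst_snd] at hv'
  change HasFDerivAt _ (vT • _ + vX • _) _ at hv'
  have h1 := HasFDerivAt.comp (t, x) (f := fun q : ℝ × ℝ =>
    (((Φ (q.1, q.2, u q.1 q.2)).1, (Φ (q.1, q.2, u q.1 q.2)).2.1) : ℝ × ℝ))
    hv' (hg.fst.prodMk hg.snd.fst)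
  have h2 := hg.snd.snd
  have h3 := h1.congr_of_eventuallyEq (f₁ := fun q : ℝ × ℝ => (Φ (q.1, q.2, u q.1 q.2)).2.2)
    (by filter_upwards [h] with q hq using hq.symm)
  have h4 := h2.unique h3
  constructor
  · have := DFunLike.congr_fun h4 (1, 0)
    simp [fderiv_apply_eq_partials] at this
    simp [A, this]
  · have := DFunLike.congr_fun h4 (0, 1)
    simp [fderiv_apply_eq_partials] at this
    simp [B, this]

/-- The transform of the germ of a smooth function exists if the graph is mapped to a graph. -/
theorem IsPointTransformation.exists_transform (h : IsPointTransformation Φ Ω) {u : ℝ → ℝ → ℝ}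
    {t x z a b : ℝ} (hz : u t x = z) (hp : (t, x, z) ∈ Ω)
    (hu : HasFDerivAt (fun q : ℝ × ℝ => u q.1 q.2)
      (a • ContinuousLinearMap.fst ℝ ℝ ℝ + b • ContinuousLinearMap.snd ℝ ℝ ℝ) (t, x))
    (hu' : ContDiffAt ℝ ∞ (fun q : ℝ × ℝ => u q.1 q.2) (t, x))
    (hD : (partialT Φ (t, x, z) + a • partialU Φ (t, x, z)).1
        * (partialX Φ (t, x, z) + b • partialU Φ (t, x, z)).2.1
      - (partialX Φ (t, x, z) + b • partialU Φ (t, x, z)).1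
        * (partialT Φ (t, x, z) + a • partialU Φ (t, x, z)).2.1 ≠ 0) :
    ∃ (v : ℝ → ℝ → ℝ) (G : ℝ × ℝ → ℝ × ℝ),
      ContDiffAt ℝ ∞ (fun q : ℝ × ℝ => v q.1 q.2) ((Φ (t, x, z)).1, (Φ (t, x, z)).2.1) ∧
      TransformsGraphNear Φ u v t x ∧
      ContDiffAt ℝ ∞ G ((Φ (t, x, z)).1, (Φ (t, x, z)).2.1) ∧
      G ((Φ (t, x, z)).1, (Φ (t, x, z)).2.1) = (t, x) ∧
      ∀ᶠ Q in 𝓝 ((Φ (t, x, z)).1, (Φ (t, x, z)).2.1),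
        ((Φ ((G Q).1, (G Q).2, u (G Q).1 (G Q).2)).1,
          (Φ ((G Q).1, (G Q).2, u (G Q).1 (G Q).2)).2.1) = Q := by
  subst hz
  set A := partialT Φ (t, x, u t x) + a • partialU Φ (t, x, u t x) with hA
  set B := partialX Φ (t, x, u t x) + b • partialU Φ (t, x, u t x) with hB
  have hg := HasFDerivAt.comp_graph (h.hasFDerivAt hp) hu
  set F : ℝ × ℝ → ℝ × ℝ := fun q =>
    ((Φ (q.1, q.2, u q.1 q.2)).1, (Φ (q.1, q.2, u q.1 q.2)).2.1) with hF
  have hF' := hg.fst.prodMk hg.snd.fst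
  have hgC : ContDiffAt ℝ ∞ (fun q : ℝ × ℝ => Φ (q.1, q.2, u q.1 q.2)) (t, x) :=
    ContDiffAt.comp (t, x) (f := fun q : ℝ × ℝ => ((q.1, q.2, u q.1 q.2) : ℝ × ℝ × ℝ))
      (h.contDiffAt hp) (contDiffAt_fst.prodMk (contDiffAt_snd.prodMk hu'))
  have hFC : ContDiffAt ℝ ∞ F (t, x) := hgC.fst.prodMk hgC.snd.fst
  have hinj : Function.Injective (fderiv ℝ F (t, x)) := by
    rw [injective_iff_map_eq_zero]
    rintro ⟨r, s⟩ hrs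
    rw [HasFDerivAt.fderiv (f := F) hF'] at hrs
    simp [fderiv_apply_eq_partials] at hrs
    obtain ⟨h1, h2⟩ := hrs
    have h1' : r * A.1 + s * B.1 = 0 := by simp [hA, hB]; linarith
    have h2' : r * A.2.1 + s * B.2.1 = 0 := by simp [hA, hB]; linarith
    have hr : r = 0 := by
      have : (A.1 * B.2.1 - B.1 * A.2.1) * r = 0 := by
        linear_combination B.2.1 * h1' - B.1 * h2'
      exact (mul_eq_zero.1 this).resolve_left hD
    have hs : s = 0 := by
      have : (A.1 * B.2.1 - B.1 * A.2.1) * s = 0 := by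
        linear_combination -A.2.1 * h1' + A.1 * h2'
      exact (mul_eq_zero.1 this).resolve_left hD
    simp [hr, hs]
  let e : (ℝ × ℝ) ≃L[ℝ] (ℝ × ℝ) :=
    (LinearEquiv.ofInjectiveEndo (fderiv ℝ F (t, x)).toLinearMap hinj).toContinuousLinearEquiv
  have he : HasFDerivAt F (e : (ℝ × ℝ) →L[ℝ] (ℝ × ℝ)) (t, x) := by
    refine (hFC.differentiableAt (by simp)).hasFDerivAt.congr_fderiv ?_
    ext <;> rfl
  have hn : (∞ : ℕ∞ω) ≠ 0 := by simp
  have hs := hFC.hasStrictFDerivAt' he hn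
  let G := hFC.localInverse he hn
  have hG : ContDiffAt ℝ ∞ G (F (t, x)) := hFC.to_localInverse he hn
  have hG0 : G (F (t, x)) = (t, x) := hFC.localInverse_apply_image he hn
  refine ⟨fun T X => (Φ ((G (T, X)).1, (G (T, X)).2, u (G (T, X)).1 (G (T, X)).2)).2.2, G,
    ?_, ?_, hG, hG0, hs.eventually_right_inverse⟩
  · exact (ContDiffAt.comp (F (t, x)) (hG0.symm ▸ hgC) hG).snd.snd
  · have := hs.eventually_left_inverse
    filter_upwards [this] with q hq
    have hq' : G ((Φ (q.1, q.2, u q.1 q.2)).1, (Φ (q.1, q.2, u q.1 q.2)).2.1) = q := hq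
    simp only [hq']

/-- If two functions differ by a quantity `δ` along the preimage of a line `T = const`, the
difference of their transforms along that line equals `δ` to leading order, up to a factor. -/
theorem IsPointTransformation.tendsto_transform_sub (h : IsPointTransformation Φ Ω)
    {u₁ u₂ v₁ v₂ : ℝ → ℝ → ℝ} {t x z L : ℝ} {γ : ℝ → ℝ × ℝ} (hp : (t, x, z) ∈ Ω)
    (hz₁ : u₁ t x = z) (hz₂ : u₂ t x = z)
    (hu₁ : ContDiffAt ℝ ∞ (fun q : ℝ × ℝ => u₁ q.1 q.2) (t, x))
    (hu₂ : ContDiffAt ℝ ∞ (fun q : ℝ × ℝ => u₂ q.1 q.2) (t, x))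
    (hv₁ : ContDiffAt ℝ ∞ (fun q : ℝ × ℝ => v₁ q.1 q.2)
      ((Φ (t, x, z)).1, (Φ (t, x, z)).2.1))
    (h₁ : TransformsGraphNear Φ u₁ v₁ t x) (h₂ : TransformsGraphNear Φ u₂ v₂ t x)
    (hγ : ContinuousAt γ 0) (hγ0 : γ 0 = (t, x))
    (hγΦ : ∀ᶠ s in 𝓝 (0 : ℝ), ((Φ ((γ s).1, (γ s).2, u₂ (γ s).1 (γ s).2)).1,
      (Φ ((γ s).1, (γ s).2, u₂ (γ s).1 (γ s).2)).2.1)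
        = ((Φ (t, x, z)).1, (Φ (t, x, z)).2.1 + s)) {k : ℕ}
    (hδ : Tendsto (fun s => (u₂ (γ s).1 (γ s).2 - u₁ (γ s).1 (γ s).2) / s ^ k) (𝓝[≠] 0) (𝓝 L)) :
    Tendsto (fun s => (v₂ (Φ (t, x, z)).1 (s + (Φ (t, x, z)).2.1)
        - v₁ (Φ (t, x, z)).1 (s + (Φ (t, x, z)).2.1)) / s ^ k) (𝓝[≠] 0)
      (𝓝 (((partialU Φ (t, x, z)).2.2
        - deriv (fun s => v₁ s (Φ (t, x, z)).2.1) (Φ (t, x, z)).1 * (partialU Φ (t, x, z)).1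
        - deriv (fun y => v₁ (Φ (t, x, z)).1 y) (Φ (t, x, z)).2.1 * (partialU Φ (t, x, z)).2.1)
        * L)) := by
  set T₀ := (Φ (t, x, z)).1 with hT₀
  set X₀ := (Φ (t, x, z)).2.1 with hX₀
  set κ := (partialU Φ (t, x, z)).2.2 - deriv (fun s => v₁ s X₀) T₀ * (partialU Φ (t, x, z)).1
        - deriv (fun y => v₁ T₀ y) X₀ * (partialU Φ (t, x, z)).2.1 with hκ
  let Ψ : ℝ × ℝ × ℝ → ℝ := fun p => (Φ p).2.2 - v₁ (Φ p).1 (Φ p).2.1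
  have hΨC : ContDiffAt ℝ ∞ Ψ (t, x, z) := by
    have hΦ := h.contDiffAt hp
    exact hΦ.snd.snd.sub (ContDiffAt.comp (t, x, z)
      (f := fun p => (((Φ p).1, (Φ p).2.1) : ℝ × ℝ)) hv₁ (hΦ.fst.prodMk hΦ.snd.fst))
  have hΨ := hΨC.hasStrictFDerivAt (by simp)
  have hκ' : fderiv ℝ Ψ (t, x, z) (0, 0, 1) = κ := by
    have hΦ := h.hasFDerivAt hp
    have hv' := (hv₁.differentiableAt (by simp)).hasFDerivAt
    rw [hv'.eq_fst_snd] at hv'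
    have h1 := HasFDerivAt.comp (t, x, z) (f := fun p => (((Φ p).1, (Φ p).2.1) : ℝ × ℝ)) hv'
      (hΦ.fst.prodMk hΦ.snd.fst)
    have h2 : HasFDerivAt Ψ _ _ := hΦ.snd.snd.sub h1
    rw [h2.fderiv]
    simp [partialU, hκ]
    ring
  set δ : ℝ → ℝ := fun s => u₂ (γ s).1 (γ s).2 - u₁ (γ s).1 (γ s).2 with hδ_def
  let P : (ℝ → ℝ → ℝ) → ℝ → ℝ × ℝ × ℝ := fun u s => ((γ s).1, (γ s).2, u (γ s).1 (γ s).2)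
  have hP : ∀ u : ℝ → ℝ → ℝ, u t x = z → ContDiffAt ℝ ∞ (fun q : ℝ × ℝ => u q.1 q.2) (t, x) →
      Tendsto (P u) (𝓝 0) (𝓝 (t, x, z)) := by
    intro u hz hu
    have h1 : ContinuousAt (fun q : ℝ × ℝ => ((q.1, q.2, u q.1 q.2) : ℝ × ℝ × ℝ)) (t, x) :=
      continuousAt_fst.prodMk (continuousAt_snd.prodMk hu.continuousAt)
    have h2 : ContinuousAt (P u) 0 := ContinuousAt.comp (x := (0 : ℝ)) (hγ0.symm ▸ h1) hγ
    have h3 : P u 0 = (t, x, z) := by simp [P, hγ0, hz]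
    exact h3 ▸ h2
  have hlim : Tendsto (fun s => (P u₂ s, P u₁ s)) (𝓝[≠] 0) (𝓝 ((t, x, z), (t, x, z))) :=
    ((hP u₂ hz₂ hu₂).prodMk_nhds (hP u₁ hz₁ hu₁)).mono_left nhdsWithin_le_nhds
  have hO := hΨ.isLittleO.comp_tendsto hlim
  have hO1 : (fun s => (v₂ T₀ (s + X₀) - v₁ T₀ (s + X₀)) - κ * δ s) =o[𝓝[≠] 0] δ := by
    refine Asymptotics.IsLittleO.congr' (hO.trans_isBigO (k := δ)
      (Asymptotics.IsBigO.of_bound 1 (Eventually.of_forall fun s => ?_))) ?_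
        (EventuallyEq.refl _ _)
    · simp [P, δ, Prod.norm_def]
    · have e1 : ∀ᶠ s in 𝓝 (0 : ℝ), v₁ (Φ (P u₁ s)).1 (Φ (P u₁ s)).2.1 = (Φ (P u₁ s)).2.2 :=
        (hγ0 ▸ hγ.tendsto).eventually h₁
      have e2 : ∀ᶠ s in 𝓝 (0 : ℝ), v₂ (Φ (P u₂ s)).1 (Φ (P u₂ s)).2.1 = (Φ (P u₂ s)).2.2 :=
        (hγ0 ▸ hγ.tendsto).eventually h₂
      filter_upwards [e1.filter_mono nhdsWithin_le_nhds, e2.filter_mono nhdsWithin_le_nhds,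
        hγΦ.filter_mono nhdsWithin_le_nhds] with s hs1 hs2 hs3
      have h4 : (Φ (P u₂ s)).1 = T₀ := (Prod.ext_iff.1 hs3).1
      have h5 : (Φ (P u₂ s)).2.1 = X₀ + s := (Prod.ext_iff.1 hs3).2
      have h6 : P u₂ s - P u₁ s = δ s • (0, 0, 1) := by simp [P, δ]
      rw [h4, h5] at hs2
      simp only [Function.comp_apply, h6, map_smul, hκ', smul_eq_mul]
      simp only [Ψ, hs1, ← hs2, h4, h5, add_comm s X₀]
      ring
  have hO2 : δ =O[𝓝[≠] 0] fun s => s ^ k := by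
    refine Asymptotics.isBigO_of_div_tendsto_nhds ?_ L hδ
    filter_upwards [self_mem_nhdsWithin] with s hs h0
    exact absurd h0 (pow_ne_zero _ hs)
  have hlast := (hO1.trans_isBigO hO2).tendsto_div_nhds_zero
  have := hlast.add (hδ.const_mul κ)
  rw [zero_add] at this
  refine this.congr fun s => ?_
  ring

end transform

section jets

variable {Φ : ℝ × ℝ × ℝ → ℝ × ℝ × ℝ} {Ω : Set (ℝ × ℝ × ℝ)}

/-- The transform of a function with a prescribed jet, with a curve `γ` in the `(t, x)` plane that
is mapped, over this function, to a line `T = const`. -/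
theorem IsPointTransformation.exists_jet_transform (h : IsPointTransformation Φ Ω) {t x z : ℝ}
    (hp : (t, x, z) ∈ Ω) {a b : ℝ} (c₃ c₄ c₅ e : ℝ) {D : ℝ}
    (hD : (partialT Φ (t, x, z) + a • partialU Φ (t, x, z)).1
        * (partialX Φ (t, x, z) + b • partialU Φ (t, x, z)).2.1
      - (partialX Φ (t, x, z) + b • partialU Φ (t, x, z)).1
        * (partialT Φ (t, x, z) + a • partialU Φ (t, x, z)).2.1 = D) (hD0 : D ≠ 0) :
    ∃ (v : ℝ → ℝ → ℝ) (γ : ℝ → ℝ × ℝ),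
      ContDiffAt ℝ ∞ (fun q : ℝ × ℝ => v q.1 q.2) ((Φ (t, x, z)).1, (Φ (t, x, z)).2.1) ∧
      TransformsGraphNear Φ (jetFunction t x z a b c₃ c₄ c₅ e) v t x ∧
      ContinuousAt γ 0 ∧ γ 0 = (t, x) ∧
      (∀ᶠ s in 𝓝 (0 : ℝ),
        ((Φ ((γ s).1, (γ s).2, jetFunction t x z a b c₃ c₄ c₅ e (γ s).1 (γ s).2)).1,
          (Φ ((γ s).1, (γ s).2, jetFunction t x z a b c₃ c₄ c₅ e (γ s).1 (γ s).2)).2.1)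
          = ((Φ (t, x, z)).1, (Φ (t, x, z)).2.1 + s)) ∧
      Tendsto (fun s => ((γ s).1 - t) / s) (𝓝[≠] 0)
        (𝓝 (-(partialX Φ (t, x, z) + b • partialU Φ (t, x, z)).1 / D)) ∧
      Tendsto (fun s => ((γ s).2 - x) / s) (𝓝[≠] 0)
        (𝓝 ((partialT Φ (t, x, z) + a • partialU Φ (t, x, z)).1 / D)) := by
  set A := partialT Φ (t, x, z) + a • partialU Φ (t, x, z) with hA
  set B := partialX Φ (t, x, z) + b • partialU Φ (t, x, z) with hB
  set u := jetFunction t x z a b c₃ c₄ c₅ e with hu_def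
  have hz : u t x = z := by simp [hu_def]
  have hu := hasFDerivAt_jetFunction t x z a b c₃ c₄ c₅ e
  obtain ⟨v, G, hv, htr, hG, hG0, hGF⟩ := h.exists_transform hz hp hu
    (contDiff_jetFunction t x z a b c₃ c₄ c₅ e).contDiffAt (by rw [← hA, ← hB, hD]; exact hD0)
  set T₀ := (Φ (t, x, z)).1
  set X₀ := (Φ (t, x, z)).2.1
  let ℓ : ℝ → ℝ × ℝ := fun s => (T₀, X₀ + s)
  have hℓ : HasDerivAt ℓ (0, 1) 0 :=
    (hasDerivAt_const (0 : ℝ) T₀).prodMk ((hasDerivAt_id (0 : ℝ)).const_add X₀)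
  have hℓ0 : ℓ 0 = (T₀, X₀) := by simp [ℓ]
  have hγ' : HasDerivAt (fun s => G (ℓ s)) (fderiv ℝ G (T₀, X₀) (0, 1)) 0 :=
    HasFDerivAt.comp_hasDerivAt (0 : ℝ) (hℓ0 ▸ (hG.differentiableAt (by simp)).hasFDerivAt) hℓ
  set g := fderiv ℝ G (T₀, X₀) (0, 1)
  have hγ0 : G (ℓ 0) = (t, x) := by rw [hℓ0, hG0]
  have hev : ∀ᶠ s in 𝓝 (0 : ℝ), ((Φ ((G (ℓ s)).1, (G (ℓ s)).2, u (G (ℓ s)).1 (G (ℓ s)).2)).1,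
      (Φ ((G (ℓ s)).1, (G (ℓ s)).2, u (G (ℓ s)).1 (G (ℓ s)).2)).2.1) = (T₀, X₀ + s) :=
    (hℓ0 ▸ hℓ.continuousAt.tendsto).eventually hGF
  have hF := HasFDerivAt.comp_graph (hz.symm ▸ h.hasFDerivAt hp) hu
  have hcomp := HasFDerivAt.comp_hasDerivAt (0 : ℝ) (hγ0.symm ▸ hF) hγ'
  have e1 : g.1 * A.1 + g.2 * B.1 = 0 := by
    have h1 := (HasFDerivAt.comp_hasDerivAt (0 : ℝ) hasFDerivAt_fst hcomp).congr_of_eventuallyEq (f₁ := fun _ => T₀)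
      (by filter_upwards [hev] with s hs using ((Prod.ext_iff.1 hs).1).symm)
    have h2 := h1.unique (hasDerivAt_const (0 : ℝ) T₀)
    simp [fderiv_apply_eq_partials, hz] at h2
    simp [hA, hB]; linarith
  have e2 : g.1 * A.2.1 + g.2 * B.2.1 = 1 := by
    have h1 := (HasFDerivAt.comp_hasDerivAt (0 : ℝ) (hasFDerivAt_fst.comp _ hasFDerivAt_snd) hcomp).congr_of_eventuallyEq (f₁ := fun s => X₀ + s)
      (by filter_upwards [hev] with s hs using ((Prod.ext_iff.1 hs).2).symm)
    have h2 := h1.unique ((hasDerivAt_id (0 : ℝ)).const_add X₀)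
    simp [fderiv_apply_eq_partials, hz] at h2
    simp [hA, hB]; linarith
  have g1 : g.1 = -B.1 / D := by
    rw [eq_div_iff hD0]; linear_combination B.2.1 * e1 - B.1 * e2 - g.1 * hD
  have g2 : g.2 = A.1 / D := by
    rw [eq_div_iff hD0]; linear_combination -A.2.1 * e1 + A.1 * e2 - g.2 * hD
  refine ⟨v, fun s => G (ℓ s), hv, htr, hγ'.continuousAt, hγ0, hev, ?_, ?_⟩
  · have := (hasDerivAt_iff_tendsto_slope_zero.1 hγ'.fst)
    rw [← g1]
    refine this.congr fun s => ?_
    rw [zero_add, hγ0, smul_eq_mul, div_eq_inv_mul]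
  · have := (hasDerivAt_iff_tendsto_slope_zero.1 hγ'.snd)
    rw [← g2]
    refine this.congr fun s => ?_
    rw [zero_add, hγ0, smul_eq_mul, div_eq_inv_mul]

/-- A graph is not tangent to the kernel of the first prolongation. -/
theorem IsPointTransformation.transversal_ne_zero (h : IsPointTransformation Φ Ω)
    {p : ℝ × ℝ × ℝ} (hp : p ∈ Ω) {vT vX a b : ℝ}
    (hA : vT * (partialT Φ p + a • partialU Φ p).1 + vX * (partialT Φ p + a • partialU Φ p).2.1
      = (partialT Φ p + a • partialU Φ p).2.2)
    (hB : vT * (partialX Φ p + b • partialU Φ p).1 + vX * (partialX Φ p + b • partialU Φ p).2.1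
      = (partialX Φ p + b • partialU Φ p).2.2) :
    (partialU Φ p).2.2 - vT * (partialU Φ p).1 - vX * (partialU Φ p).2.1 ≠ 0 := by
  intro h0
  obtain ⟨r, s, m, hw⟩ := h.exists_combination hp (0, 0, 1)
  have h1 := congrArg Prod.fst hw
  have h2 := congrArg (fun q => q.2.1) hw
  have h3 := congrArg (fun q => q.2.2) hw
  simp at h1 h2 h3 hA hB
  have : (1 : ℝ) = 0 := by
    linear_combination -h3 + vT * h1 + vX * h2 - r * hA - s * hB + (m - r * a - s * b) * h0
  exact one_ne_zero this

theorem iteratedDeriv_sub_translate {f g : ℝ → ℝ} {x : ℝ} (hf : ContDiffAt ℝ ∞ f x)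
    (hg : ContDiffAt ℝ ∞ g x) (k : ℕ) :
    iteratedDeriv k (fun s => f (s + x) - g (s + x)) 0
      = iteratedDeriv k f x - iteratedDeriv k g x := by
  have h1 := iteratedDeriv_comp_add_const k (fun y => f y - g y) x
  have h2 := congrFun h1 0
  simp only [zero_add] at h2
  rw [h2]
  exact iteratedDeriv_fun_sub (hf.of_le (by exact_mod_cast le_top))
    (hg.of_le (by exact_mod_cast le_top))

theorem ContDiffAt.slice {v : ℝ → ℝ → ℝ} {t x : ℝ}
    (hv : ContDiffAt ℝ ∞ (fun q : ℝ × ℝ => v q.1 q.2) (t, x)) : ContDiffAt ℝ ∞ (v t) x :=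
  ContDiffAt.comp x (f := fun y : ℝ => ((t, y) : ℝ × ℝ)) hv (contDiffAt_const.prodMk contDiffAt_id)

/-- The derivatives of two transforms that differ to fifth order only. -/
theorem iteratedDeriv_of_tendsto_sub {v₁ v₂ : ℝ → ℝ → ℝ} {T X l : ℝ}
    (hv₁ : ContDiffAt ℝ ∞ (fun q : ℝ × ℝ => v₁ q.1 q.2) (T, X))
    (hv₂ : ContDiffAt ℝ ∞ (fun q : ℝ × ℝ => v₂ q.1 q.2) (T, X)) {k : ℕ}
    (h : Tendsto (fun s => (v₂ T (s + X) - v₁ T (s + X)) / s ^ k) (𝓝[≠] 0) (𝓝 l)) :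
    (∀ j < k, iteratedDeriv j (fun y => v₂ T y) X = iteratedDeriv j (fun y => v₁ T y) X) ∧
      iteratedDeriv k (fun y => v₂ T y) X - iteratedDeriv k (fun y => v₁ T y) X
        = k.factorial * l := by
  have hs : ∀ f : ℝ → ℝ, ContDiffAt ℝ ∞ f X → ContDiffAt ℝ ∞ (fun s => f (s + X)) 0 := by
    intro f hf
    exact ContDiffAt.comp (0 : ℝ) (f := fun s : ℝ => s + X) (by simpa using hf)
      (contDiffAt_id.add contDiffAt_const)
  have hw := (hs _ hv₂.slice).sub (hs _ hv₁.slice)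
  obtain ⟨h1, h2⟩ := iteratedDeriv_of_tendsto_div_pow hw h
  constructor
  · intro j hj
    have := h1 j hj
    rw [iteratedDeriv_sub_translate hv₂.slice hv₁.slice] at this
    exact sub_eq_zero.1 this
  · rw [iteratedDeriv_sub_translate hv₂.slice hv₁.slice] at h2
    exact h2

end jets

namespace KawaharaEq.IsMappedBy

variable {E E' : KawaharaEq} {Φ : ℝ × ℝ × ℝ → ℝ × ℝ × ℝ} {Ω : Set (ℝ × ℝ × ℝ)}

theorem equation_of_jet (H : E.IsMappedBy E' Φ Ω) {t x z a b c₃ c₄ c₅ e : ℝ}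
    (hp : (t, x, z) ∈ Ω) {v : ℝ → ℝ → ℝ}
    (hv : ContDiffAt ℝ ∞ (fun q : ℝ × ℝ => v q.1 q.2) ((Φ (t, x, z)).1, (Φ (t, x, z)).2.1))
    (h : TransformsGraphNear Φ (jetFunction t x z a b c₃ c₄ c₅ e) v t x)
    (hE : a + E.α t * z ^ E.n * b + 6 * E.β t * c₃ + 120 * E.σ t * c₅ = 0) :
    deriv (fun s => v s (Φ (t, x, z)).2.1) (Φ (t, x, z)).1
      + E'.α (Φ (t, x, z)).1 * (Φ (t, x, z)).2.2 ^ E'.n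
        * deriv (fun y => v (Φ (t, x, z)).1 y) (Φ (t, x, z)).2.1
      + E'.β (Φ (t, x, z)).1 * iteratedDeriv 3 (fun y => v (Φ (t, x, z)).1 y) (Φ (t, x, z)).2.1
      + E'.σ (Φ (t, x, z)).1 * iteratedDeriv 5 (fun y => v (Φ (t, x, z)).1 y) (Φ (t, x, z)).2.1
      = 0 := by
  have h1 := H.holdsAt_iff (jetFunction t x z a b c₃ c₄ c₅ e) v t x
    (by simpa using hp) (contDiff_jetFunction t x z a b c₃ c₄ c₅ e).contDiffAt (by simpa using hv) h
  have h2 := h1.1 ((E.holdsAt_jetFunction_iff t x z a b c₃ c₄ c₅ e).2 hE)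
  have h3 := h.self_of_nhds
  simp only [jetFunction_self] at h3 h2
  unfold KawaharaEq.HoldsAt at h2
  rwa [h3] at h2

end KawaharaEq.IsMappedBy

theorem exists_affine_ne_zero {l₀ l₁ m₀ m₁ m₂ : ℝ} (hl : l₀ ≠ 0 ∨ l₁ ≠ 0)
    (hm : m₀ ≠ 0 ∨ m₁ ≠ 0 ∨ m₂ ≠ 0) : ∃ a b : ℝ, l₀ + b * l₁ ≠ 0 ∧ m₀ + b * m₁ + a * m₂ ≠ 0 := by
  by_contra! hcon
  have h : ∀ a b : ℝ, (l₀ + b * l₁) * (m₀ + b * m₁ + a * m₂) = 0 := by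
    intro a b
    by_cases h0 : l₀ + b * l₁ = 0
    · rw [h0, zero_mul]
    · rw [hcon a b h0, mul_zero]
  have h00 := h 0 0
  have h01 := h 0 1
  have h02 := h 0 (-1)
  have h10 := h 1 0
  have h11 := h 1 1
  have i1 : l₀ * m₀ = 0 := by linarith
  have i2 : l₁ * m₁ = 0 := by linarith
  have i3 : l₀ * m₁ + l₁ * m₀ = 0 := by linarith
  have i4 : l₀ * m₂ = 0 := by linarith
  have i5 : l₁ * m₂ = 0 := by linarith
  rcases hl with hl | hl
  · have : m₀ = 0 := by simpa [hl] using i1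
    have : m₁ = 0 := by simpa [hl, this] using i3
    have : m₂ = 0 := by simpa [hl] using i4
    simp_all
  · have : m₁ = 0 := by simpa [hl] using i2
    have : m₀ = 0 := by simpa [hl, this] using i3
    have : m₂ = 0 := by simpa [hl] using i5
    simp_all

theorem mem_ball_triple {t x z t' x' z' ε : ℝ} :
    ((t', x', z') : ℝ × ℝ × ℝ) ∈ Metric.ball ((t, x, z) : ℝ × ℝ × ℝ) ε ↔
      |t' - t| < ε ∧ |x' - x| < ε ∧ |z' - z| < ε := by
  simp [Metric.mem_ball, Prod.dist_eq, Real.dist_eq]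

/-- The mean value theorem on a slice `t = const` of a ball. -/
theorem exists_mean_value_slice {f : ℝ × ℝ × ℝ → ℝ} {p : ℝ × ℝ × ℝ} {ε : ℝ}
    (hf : ∀ r ∈ Metric.ball p ε, DifferentiableAt ℝ f r) {t x x' z z' : ℝ}
    (hq : (t, x, z) ∈ Metric.ball p ε) (hq' : (t, x', z') ∈ Metric.ball p ε) :
    ∃ θ ∈ Set.Icc (0 : ℝ) 1, (t, x + θ * (x' - x), z + θ * (z' - z)) ∈ Metric.ball p ε ∧
      f (t, x', z') - f (t, x, z)
        = fderiv ℝ f (t, x + θ * (x' - x), z + θ * (z' - z)) (0, x' - x, z' - z) := by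
  obtain ⟨r, hr, h⟩ := domain_mvt (f := f) (f' := fderiv ℝ f) (s := Metric.ball p ε)
    (fun r hr => (hf r hr).hasFDerivAt.hasFDerivWithinAt) (convex_ball p ε) hq hq'
  have hrB := (convex_ball p ε).segment_subset hq hq' hr
  rw [segment_eq_image'] at hr
  obtain ⟨θ, hθ, rfl⟩ := hr
  have e : ((t, x, z) : ℝ × ℝ × ℝ) + θ • ((t, x', z') - (t, x, z))
      = (t, x + θ * (x' - x), z + θ * (z' - z)) := by simp
  simp only [e] at hrB h
  refine ⟨θ, hθ, hrB, ?_⟩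
  rw [h]
  simp

section components

variable {Φ : ℝ × ℝ × ℝ → ℝ × ℝ × ℝ}

theorem fderiv_fst_apply {p : ℝ × ℝ × ℝ} (h : DifferentiableAt ℝ Φ p) (r s w : ℝ) :
    fderiv ℝ (fun q => (Φ q).1) p (r, s, w)
      = r * (partialT Φ p).1 + s * (partialX Φ p).1 + w * (partialU Φ p).1 := by
  rw [h.hasFDerivAt.fst.fderiv]
  simp [fderiv_apply_eq_partials]

theorem fderiv_snd_fst_apply {p : ℝ × ℝ × ℝ} (h : DifferentiableAt ℝ Φ p) (r s w : ℝ) :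
    fderiv ℝ (fun q => (Φ q).2.1) p (r, s, w)
      = r * (partialT Φ p).2.1 + s * (partialX Φ p).2.1 + w * (partialU Φ p).2.1 := by
  rw [h.hasFDerivAt.snd.fst.fderiv]
  simp [fderiv_apply_eq_partials]

theorem fderiv_snd_snd_apply {p : ℝ × ℝ × ℝ} (h : DifferentiableAt ℝ Φ p) (r s w : ℝ) :
    fderiv ℝ (fun q => (Φ q).2.2) p (r, s, w)
      = r * (partialT Φ p).2.2 + s * (partialX Φ p).2.2 + w * (partialU Φ p).2.2 := by
  rw [h.hasFDerivAt.snd.snd.fderiv]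
  simp [fderiv_apply_eq_partials]

end components

namespace KawaharaEq.IsMappedBy

variable {E E' : KawaharaEq} {Φ : ℝ × ℝ × ℝ → ℝ × ℝ × ℝ} {Ω : Set (ℝ × ℝ × ℝ)}

theorem σ_ne_zero' (H : E.IsMappedBy E' Φ Ω) {p : ℝ × ℝ × ℝ} (hp : p ∈ Ω) :
    E'.σ (Φ p).1 ≠ 0 :=
  E'.σ_ne_zero _ (H.mapsTo_domain hp).1

theorem σ_ne_zero (H : E.IsMappedBy E' Φ Ω) {p : ℝ × ℝ × ℝ} (hp : p ∈ Ω) : E.σ p.1 ≠ 0 :=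
  E.σ_ne_zero _ (H.subset_domain hp).1

theorem differentiableAt (H : E.IsMappedBy E' Φ Ω) {p : ℝ × ℝ × ℝ} (hp : p ∈ Ω) :
    DifferentiableAt ℝ Φ p := (H.isPointTransformation.hasFDerivAt hp).differentiableAt

/-- The new time depends on the old time only. -/
theorem partial_time_eq_zero (H : E.IsMappedBy E' Φ Ω) {p : ℝ × ℝ × ℝ} (hp : p ∈ Ω) :
    (partialX Φ p).1 = 0 ∧ (partialU Φ p).1 = 0 := by
  obtain ⟨t, x, z⟩ := p
  have hΦ := H.isPointTransformation
  by_contra hcon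
  obtain ⟨a, b, hl, hm⟩ := exists_affine_ne_zero (l₀ := (partialX Φ (t, x, z)).1)
    (l₁ := (partialU Φ (t, x, z)).1)
    (m₀ := (partialT Φ (t, x, z)).1 * (partialX Φ (t, x, z)).2.1
      - (partialX Φ (t, x, z)).1 * (partialT Φ (t, x, z)).2.1)
    (m₁ := (partialT Φ (t, x, z)).1 * (partialU Φ (t, x, z)).2.1
      - (partialU Φ (t, x, z)).1 * (partialT Φ (t, x, z)).2.1)
    (m₂ := (partialU Φ (t, x, z)).1 * (partialX Φ (t, x, z)).2.1
      - (partialX Φ (t, x, z)).1 * (partialU Φ (t, x, z)).2.1)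
    (by by_contra! h; exact hcon h) (by
      by_contra! h
      obtain ⟨h0, h1, h2⟩ := h
      obtain ⟨r, s, m, hw⟩ := hΦ.exists_combination hp (1, 0, 0)
      obtain ⟨r', s', m', hw'⟩ := hΦ.exists_combination hp (0, 1, 0)
      have i1 := congrArg Prod.fst hw
      have i2 := congrArg (fun q => q.2.1) hw
      have i3 := congrArg Prod.fst hw'
      have i4 := congrArg (fun q => q.2.1) hw'
      simp at i1 i2 i3 i4
      have : (1 : ℝ) = 0 := by
        linear_combination (r * s' - s * r') * h0 + (r * m' - m * r') * h1
          + (m * s' - s * m') * h2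
          - (r' * (partialT Φ (t, x, z)).2.1 + s' * (partialX Φ (t, x, z)).2.1
            + m' * (partialU Φ (t, x, z)).2.1) * i1 - i4
          + (r * (partialT Φ (t, x, z)).2.1 + s * (partialX Φ (t, x, z)).2.1
            + m * (partialU Φ (t, x, z)).2.1) * i3
      exact one_ne_zero this)
  have hσ := H.σ_ne_zero hp
  have hσ' := H.σ_ne_zero' hp
  simp only at hσ
  obtain ⟨D, hD⟩ : ∃ D, (partialT Φ (t, x, z) + a • partialU Φ (t, x, z)).1
        * (partialX Φ (t, x, z) + b • partialU Φ (t, x, z)).2.1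
      - (partialX Φ (t, x, z) + b • partialU Φ (t, x, z)).1
        * (partialT Φ (t, x, z) + a • partialU Φ (t, x, z)).2.1 = D := ⟨_, rfl⟩
  have hD0 : D ≠ 0 := by
    rw [← hD]
    intro h
    simp at h
    apply hm
    linarith
  have hE : a + E.α t * z ^ E.n * b + 6 * E.β t * 0
      + 120 * E.σ t * (-(a + E.α t * z ^ E.n * b) / (120 * E.σ t)) = 0 := by
    field_simp; ring
  set c := -(a + E.α t * z ^ E.n * b) / (120 * E.σ t)
  obtain ⟨v₁, γ₁, hv₁, htr₁, -⟩ := hΦ.exists_jet_transform hp 0 0 c 0 hD hD0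
  obtain ⟨v₂, γ, hv₂, htr₂, hγ, hγ0, hγΦ, hγt, -⟩ := hΦ.exists_jet_transform hp 0 0 c 1 hD hD0
  obtain ⟨A₁, B₁⟩ := htr₁.first_order (jetFunction_self ..) (H.differentiableAt hp)
    (hasFDerivAt_jetFunction ..) hv₁
  obtain ⟨A₂, B₂⟩ := htr₂.first_order (jetFunction_self ..) (H.differentiableAt hp)
    (hasFDerivAt_jetFunction ..) hv₂
  have hκ := hΦ.transversal_ne_zero hp A₁ B₁
  have hlim := hΦ.tendsto_transform_sub (k := 5) hp (jetFunction_self ..) (jetFunction_self ..)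
    (contDiff_jetFunction ..).contDiffAt (contDiff_jetFunction ..).contDiffAt hv₁ htr₁ htr₂ hγ hγ0
    hγΦ (L := (-(partialX Φ (t, x, z) + b • partialU Φ (t, x, z)).1 / D) ^ 5) (by
      refine (hγt.pow 5).congr fun s => ?_
      rw [div_pow]
      congr 1
      simp [jetFunction])
  obtain ⟨hlow, htop⟩ := iteratedDeriv_of_tendsto_sub hv₁ hv₂ hlim
  have q₁ := H.equation_of_jet hp hv₁ htr₁ hE
  have q₂ := H.equation_of_jet hp hv₂ htr₂ hE
  have hX : deriv (fun y => v₂ (Φ (t, x, z)).1 y) (Φ (t, x, z)).2.1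
      = deriv (fun y => v₁ (Φ (t, x, z)).1 y) (Φ (t, x, z)).2.1 := by
    simpa [iteratedDeriv_one] using hlow 1 (by norm_num)
  have hT : deriv (fun s => v₂ s (Φ (t, x, z)).2.1) (Φ (t, x, z)).1
      = deriv (fun s => v₁ s (Φ (t, x, z)).2.1) (Φ (t, x, z)).1 := by
    rw [hX] at B₂
    have h1 := B₂.trans B₁.symm
    have h2 := mul_right_cancel₀ (b := (partialX Φ (t, x, z) + b • partialU Φ (t, x, z)).1)
      (by simpa using hl) (add_right_cancel h1)
    exact h2
  have h3 := hlow 3 (by norm_num)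
  rw [hX, hT, h3] at q₂
  have h5 : E'.σ (Φ (t, x, z)).1
      * (iteratedDeriv 5 (fun y => v₂ (Φ (t, x, z)).1 y) (Φ (t, x, z)).2.1
        - iteratedDeriv 5 (fun y => v₁ (Φ (t, x, z)).1 y) (Φ (t, x, z)).2.1) = 0 := by
    linarith
  rw [htop] at h5
  have hB : (partialX Φ (t, x, z) + b • partialU Φ (t, x, z)).1 ≠ 0 := by simpa using hl
  have hB' := pow_ne_zero 5 (div_ne_zero (neg_ne_zero.2 hB) hD0)
  have h120 : ((Nat.factorial 5 : ℕ) : ℝ) ≠ 0 := by positivity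
  exact (mul_ne_zero hσ' (mul_ne_zero h120 (mul_ne_zero hκ hB'))) h5

theorem time_eq (H : E.IsMappedBy E' Φ Ω) {p : ℝ × ℝ × ℝ} {ε : ℝ} (hε : Metric.ball p ε ⊆ Ω)
    {t x x' z z' : ℝ} (hq : (t, x, z) ∈ Metric.ball p ε) (hq' : (t, x', z') ∈ Metric.ball p ε) :
    (Φ (t, x', z')).1 = (Φ (t, x, z)).1 := by
  obtain ⟨θ, -, hθ, h⟩ := exists_mean_value_slice (f := fun q => (Φ q).1)
    (fun r hr => (H.differentiableAt (hε hr)).fst) hq hq'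
  rw [fderiv_fst_apply (H.differentiableAt (hε hθ))] at h
  obtain ⟨h1, h2⟩ := H.partial_time_eq_zero (hε hθ)
  rw [h1, h2] at h
  simp at h
  linarith

theorem partialT_time_ne_zero (H : E.IsMappedBy E' Φ Ω) {p : ℝ × ℝ × ℝ} (hp : p ∈ Ω) :
    (partialT Φ p).1 ≠ 0 := by
  intro h0
  obtain ⟨h1, h2⟩ := H.partial_time_eq_zero hp
  obtain ⟨r, s, m, hw⟩ := H.isPointTransformation.exists_combination hp (1, 0, 0)
  have := congrArg Prod.fst hw
  simp [h0, h1, h2] at this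

theorem exists_ball (H : E.IsMappedBy E' Φ Ω) {p : ℝ × ℝ × ℝ} (hp : p ∈ Ω) :
    ∃ ε > 0, Metric.ball p ε ⊆ Ω :=
  Metric.mem_nhds_iff.1 (H.isPointTransformation.isOpen.mem_nhds hp)

theorem hasDerivAt_slice_time (H : E.IsMappedBy E' Φ Ω) {t x z : ℝ} (hp : (t, x, z) ∈ Ω) :
    HasDerivAt (fun τ => Φ (τ, x, z)) (partialT Φ (t, x, z)) t :=
  HasFDerivAt.comp_hasDerivAt (l := Φ) t (H.isPointTransformation.hasFDerivAt hp)
    ((hasDerivAt_id t).prodMk (hasDerivAt_const t (x, z)))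

/-- Near a point, the new time determines the old time. -/
theorem eventually_time_injective (H : E.IsMappedBy E' Φ Ω) {p : ℝ × ℝ × ℝ} (hp : p ∈ Ω) :
    ∀ᶠ q in 𝓝 p, (Φ q).1 = (Φ p).1 → q.1 = p.1 := by
  obtain ⟨t, x, z⟩ := p
  obtain ⟨ε, hε, hball⟩ := H.exists_ball hp
  have h1 : HasDerivAt (fun τ => (Φ (τ, x, z)).1) (partialT Φ (t, x, z)).1 t :=
    HasFDerivAt.comp_hasDerivAt (l := Prod.fst) (l' := ContinuousLinearMap.fst ℝ ℝ (ℝ × ℝ)) t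
      hasFDerivAt_fst (H.hasDerivAt_slice_time hp)
  have h2 := h1.eventually_ne (c := (Φ (t, x, z)).1) (H.partialT_time_ne_zero hp)
  rw [eventually_nhdsWithin_iff] at h2
  have h3 : Tendsto Prod.fst (𝓝 ((t, x, z) : ℝ × ℝ × ℝ)) (𝓝 t) := continuous_fst.tendsto _
  filter_upwards [h3.eventually h2, Metric.ball_mem_nhds _ hε] with q hq hqB hqt
  obtain ⟨τ, y, w⟩ := q
  by_contra hne
  have h4 := hq hne
  rw [mem_ball_triple] at hqB
  have : (Φ (τ, y, w)).1 = (Φ (τ, x, z)).1 := H.time_eq hball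
    (mem_ball_triple.2 ⟨hqB.1, by simpa using hε, by simpa using hε⟩) (mem_ball_triple.2 hqB)
  simp only at h4 hqt
  exact h4 (by rw [← this, hqt])

/-- The relation between the coefficients of the fifth derivatives. -/
theorem pow_five_mul_σ_of_slope (H : E.IsMappedBy E' Φ Ω) {t x z : ℝ} (hp : (t, x, z) ∈ Ω) (b : ℝ)
    (hb : (partialX Φ (t, x, z) + b • partialU Φ (t, x, z)).2.1 ≠ 0) :
    (partialX Φ (t, x, z) + b • partialU Φ (t, x, z)).2.1 ^ 5 * E.σ t
      = E'.σ (Φ (t, x, z)).1 * (partialT Φ (t, x, z)).1 := by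
  have hΦ := H.isPointTransformation
  obtain ⟨hXT, hUT⟩ := H.partial_time_eq_zero hp
  have hT := H.partialT_time_ne_zero hp
  have hD : ∀ a : ℝ, (partialT Φ (t, x, z) + a • partialU Φ (t, x, z)).1
        * (partialX Φ (t, x, z) + b • partialU Φ (t, x, z)).2.1
      - (partialX Φ (t, x, z) + b • partialU Φ (t, x, z)).1
        * (partialT Φ (t, x, z) + a • partialU Φ (t, x, z)).2.1
      = (partialT Φ (t, x, z)).1 * (partialX Φ (t, x, z) + b • partialU Φ (t, x, z)).2.1 := by
    intro a; simp [hXT, hUT]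
  have hD0 := mul_ne_zero hT hb
  set m := (partialX Φ (t, x, z) + b • partialU Φ (t, x, z)).2.1 with hm
  have hE₁ : -(E.α t * z ^ E.n * b) + E.α t * z ^ E.n * b + 6 * E.β t * 0
      + 120 * E.σ t * 0 = 0 := by ring
  have hE₂ : -(E.α t * z ^ E.n * b) - 120 * E.σ t + E.α t * z ^ E.n * b + 6 * E.β t * 0
      + 120 * E.σ t * 1 = 0 := by ring
  set a₁ := -(E.α t * z ^ E.n * b)
  set a₂ := a₁ - 120 * E.σ t with ha₂
  obtain ⟨v₁, γ₁, hv₁, htr₁, -⟩ := hΦ.exists_jet_transform hp 0 0 0 0 (hD a₁) hD0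
  obtain ⟨v₂, γ, hv₂, htr₂, hγ, hγ0, hγΦ, -, hγx⟩ := hΦ.exists_jet_transform hp 0 0 1 0 (hD a₂) hD0
  obtain ⟨A₁, B₁⟩ := htr₁.first_order (jetFunction_self ..) (H.differentiableAt hp)
    (hasFDerivAt_jetFunction ..) hv₁
  obtain ⟨A₂, B₂⟩ := htr₂.first_order (jetFunction_self ..) (H.differentiableAt hp)
    (hasFDerivAt_jetFunction ..) hv₂
  have hκ := hΦ.transversal_ne_zero hp A₁ B₁
  have hγt : ∀ᶠ s in 𝓝 (0 : ℝ), (γ s).1 = t := by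
    let P : ℝ → ℝ × ℝ × ℝ := fun s =>
      ((γ s).1, (γ s).2, jetFunction t x z a₂ b 0 0 1 0 (γ s).1 (γ s).2)
    have hP : ContinuousAt P 0 := ContinuousAt.comp (x := (0 : ℝ))
      (g := fun q : ℝ × ℝ => ((q.1, q.2, jetFunction t x z a₂ b 0 0 1 0 q.1 q.2) : ℝ × ℝ × ℝ))
      (continuousAt_fst.prodMk (continuousAt_snd.prodMk
        (contDiff_jetFunction t x z a₂ b 0 0 1 0).continuous.continuousAt)) hγ
    have hP0 : P 0 = (t, x, z) := by simp [P, hγ0]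
    filter_upwards [(hP0 ▸ hP.tendsto).eventually (H.eventually_time_injective hp), hγΦ]
      with s hs hs'
    exact hs (Prod.ext_iff.1 hs').1
  have hlim := hΦ.tendsto_transform_sub (k := 5) hp (jetFunction_self ..) (jetFunction_self ..)
    (contDiff_jetFunction ..).contDiffAt (contDiff_jetFunction ..).contDiffAt hv₁ htr₁ htr₂ hγ hγ0
    hγΦ (L := m⁻¹ ^ 5) (by
      have e : (partialT Φ (t, x, z) + a₂ • partialU Φ (t, x, z)).1
          / ((partialT Φ (t, x, z)).1 * m) = m⁻¹ := by
        simp [hUT]; field_simp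
      rw [e] at hγx
      refine (hγx.pow 5).congr' ?_
      filter_upwards [hγt.filter_mono nhdsWithin_le_nhds] with s hs
      rw [div_pow]
      congr 1
      simp [jetFunction, hs])
  obtain ⟨hlow, htop⟩ := iteratedDeriv_of_tendsto_sub hv₁ hv₂ hlim
  have q₁ := H.equation_of_jet hp hv₁ htr₁ hE₁
  have q₂ := H.equation_of_jet hp hv₂ htr₂ hE₂
  have hX : deriv (fun y => v₂ (Φ (t, x, z)).1 y) (Φ (t, x, z)).2.1
      = deriv (fun y => v₁ (Φ (t, x, z)).1 y) (Φ (t, x, z)).2.1 := by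
    simpa [iteratedDeriv_one] using hlow 1 (by norm_num)
  have h3 := hlow 3 (by norm_num)
  rw [hX] at A₂
  rw [hX, h3] at q₂
  simp only [hUT, mul_zero, sub_zero] at hκ htop
  set vX := deriv (fun y => v₁ (Φ (t, x, z)).1 y) (Φ (t, x, z)).2.1
  set vT₁ := deriv (fun s => v₁ s (Φ (t, x, z)).2.1) (Φ (t, x, z)).1
  set vT₂ := deriv (fun s => v₂ s (Φ (t, x, z)).2.1) (Φ (t, x, z)).1
  set κ := (partialU Φ (t, x, z)).2.2 - vX * (partialU Φ (t, x, z)).2.1 with hκ_def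
  simp [hUT] at A₁ A₂
  have hvT : (vT₂ - vT₁) * (partialT Φ (t, x, z)).1 = -120 * E.σ t * κ := by
    rw [hκ_def]
    linear_combination A₂ - A₁ + ((partialU Φ (t, x, z)).2.2
      - vX * (partialU Φ (t, x, z)).2.1) * ha₂
  have h5 : (vT₂ - vT₁) + E'.σ (Φ (t, x, z)).1 * (((Nat.factorial 5 : ℕ) : ℝ) * (κ * m⁻¹ ^ 5))
      = 0 := by
    rw [← htop]; linarith
  have h120 : ((Nat.factorial 5 : ℕ) : ℝ) = 120 := by norm_num [Nat.factorial]
  rw [h120] at h5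
  have hmm : m⁻¹ ^ 5 * m ^ 5 = 1 := by rw [← mul_pow, inv_mul_cancel₀ hb, one_pow]
  have : 120 * κ * (m ^ 5 * E.σ t - E'.σ (Φ (t, x, z)).1 * (partialT Φ (t, x, z)).1) = 0 := by
    linear_combination m ^ 5 * hvT - m ^ 5 * (partialT Φ (t, x, z)).1 * h5
      + E'.σ (Φ (t, x, z)).1 * 120 * κ * (partialT Φ (t, x, z)).1 * hmm
  have h120' : (120 : ℝ) * κ ≠ 0 := mul_ne_zero (by norm_num) hκ
  exact sub_eq_zero.1 ((mul_eq_zero.1 this).resolve_left h120')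

/-- The new space variable does not depend on the unknown function. -/
theorem partialU_space_eq_zero (H : E.IsMappedBy E' Φ Ω) {t x z : ℝ} (hp : (t, x, z) ∈ Ω) :
    (partialU Φ (t, x, z)).2.1 = 0 := by
  by_contra h0
  have key : ∀ c : ℝ, c ≠ 0 →
      c ^ 5 * E.σ t = E'.σ (Φ (t, x, z)).1 * (partialT Φ (t, x, z)).1 := by
    intro c hc
    have e : (partialX Φ (t, x, z) + ((c - (partialX Φ (t, x, z)).2.1)
        / (partialU Φ (t, x, z)).2.1) • partialU Φ (t, x, z)).2.1 = c := by
      simp; field_simp; ring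
    have := H.pow_five_mul_σ_of_slope hp
      ((c - (partialX Φ (t, x, z)).2.1) / (partialU Φ (t, x, z)).2.1) (by rw [e]; exact hc)
    rwa [e] at this
  have h1 := key 1 one_ne_zero
  have h2 := key 2 two_ne_zero
  have hσ := H.σ_ne_zero hp
  apply hσ
  simp only
  linarith

theorem partialX_space_ne_zero (H : E.IsMappedBy E' Φ Ω) {t x z : ℝ} (hp : (t, x, z) ∈ Ω) :
    (partialX Φ (t, x, z)).2.1 ≠ 0 := by
  intro h0
  obtain ⟨h1, h2⟩ := H.partial_time_eq_zero hp
  have h3 := H.partialU_space_eq_zero hp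
  obtain ⟨r, s, m, hw⟩ := H.isPointTransformation.exists_combination hp (0, 1, 0)
  have e1 := congrArg Prod.fst hw
  have e2 := congrArg (fun q => q.2.1) hw
  simp [h0, h1, h2, h3] at e1 e2
  rcases e1 with rfl | e1
  · simp at e2
  · exact H.partialT_time_ne_zero hp e1

theorem partialU_unknown_ne_zero (H : E.IsMappedBy E' Φ Ω) {t x z : ℝ} (hp : (t, x, z) ∈ Ω) :
    (partialU Φ (t, x, z)).2.2 ≠ 0 := by
  intro h0
  obtain ⟨-, h2⟩ := H.partial_time_eq_zero hp
  have h3 := H.partialU_space_eq_zero hp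
  have h4 : partialU Φ (t, x, z) = 0 := by
    ext <;> simp [h0, h2, h3]
  obtain ⟨e, he⟩ : ∃ e : (ℝ × ℝ × ℝ) ≃L[ℝ] (ℝ × ℝ × ℝ),
      (e : (ℝ × ℝ × ℝ) →L[ℝ] (ℝ × ℝ × ℝ)) = fderiv ℝ Φ (t, x, z) :=
    ⟨_, ContinuousLinearMap.coe_toContinuousLinearEquivOfDetNeZero _
      (H.isPointTransformation.jacobian_ne_zero _ hp)⟩
  have h5 : e (0, 0, 1) = 0 := by
    rw [← h4, partialU, ← he]; rfl
  rw [map_eq_zero_iff e e.injective] at h5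
  simp at h5

theorem pow_five_mul_σ (H : E.IsMappedBy E' Φ Ω) {t x z : ℝ} (hp : (t, x, z) ∈ Ω) :
    (partialX Φ (t, x, z)).2.1 ^ 5 * E.σ t
      = E'.σ (Φ (t, x, z)).1 * (partialT Φ (t, x, z)).1 := by
  simpa using H.pow_five_mul_σ_of_slope hp 0 (by simpa using H.partialX_space_ne_zero hp)

end KawaharaEq.IsMappedBy

/-- Second-order information on the increment of a function along a vertical perturbation of a
curve of order four. -/
theorem tendsto_quartic_increment {f g : ℝ × ℝ × ℝ → ℝ} {t x z b ε : ℝ} (hε : 0 < ε)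
    (hf : ∀ r ∈ Metric.ball (t, x, z) ε, DifferentiableAt ℝ f r)
    (hg : ∀ r ∈ Metric.ball (t, x, z) ε, fderiv ℝ f r (0, 0, 1) = g r)
    (hgd : DifferentiableAt ℝ g (t, x, z)) :
    Tendsto (fun y => (f (t, x + y, z + b * y + y ^ 4) - f (t, x + y, z + b * y)
      - g (t, x, z) * y ^ 4) / y ^ 5) (𝓝[≠] 0) (𝓝 (fderiv ℝ g (t, x, z) (0, 1, b))) := by
  have hin : ∀ c : ℝ, ∀ᶠ y in 𝓝 (0 : ℝ),
      (t, x + y, z + b * y + c * y ^ 4) ∈ Metric.ball (t, x, z) ε := by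
    intro c
    have hc : Continuous fun y : ℝ => ((t, x + y, z + b * y + c * y ^ 4) : ℝ × ℝ × ℝ) := by
      fun_prop
    exact (hc.tendsto' 0 (t, x, z) (by simp)).eventually (Metric.ball_mem_nhds _ hε)
  have hmv : ∀ᶠ y in 𝓝 (0 : ℝ), ∃ θ : ℝ, θ ∈ Set.Icc (0 : ℝ) 1 ∧
      f (t, x + y, z + b * y + y ^ 4) - f (t, x + y, z + b * y)
        = y ^ 4 * g (t, x + y, z + b * y + θ * y ^ 4) := by
    filter_upwards [hin 0, hin 1] with y h0 h1
    rw [zero_mul, add_zero] at h0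
    rw [one_mul] at h1
    obtain ⟨θ, hθ, hB, h⟩ := exists_mean_value_slice hf h0 h1
    refine ⟨θ, hθ, h.trans ?_⟩
    have e : ((0, x + y - (x + y), z + b * y + y ^ 4 - (z + b * y)) : ℝ × ℝ × ℝ)
        = y ^ 4 • (0, 0, 1) := by simp
    rw [e, map_smul, hg _ hB, smul_eq_mul]
    congr 4
    · ring
    · ring
  obtain ⟨θ, hθ⟩ := hmv.choice
  have hθ' : HasDerivAt (fun y => θ y * y ^ 4) 0 0 := by
    rw [hasDerivAt_iff_tendsto_slope_zero]
    have hlim : Tendsto (fun y : ℝ => |y| ^ 3) (𝓝[≠] 0) (𝓝 0) := by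
      have : Continuous fun y : ℝ => |y| ^ 3 := by fun_prop
      simpa using (this.tendsto 0).mono_left nhdsWithin_le_nhds
    refine squeeze_zero_norm' ?_ hlim
    filter_upwards [self_mem_nhdsWithin, hθ.filter_mono nhdsWithin_le_nhds] with y hy hy'
    have hy : y ≠ 0 := hy
    have e : y⁻¹ • (θ (0 + y) * (0 + y) ^ 4 - θ 0 * 0 ^ 4) = θ y * y ^ 3 := by
      simp; field_simp
    rw [e, norm_mul, norm_pow, Real.norm_eq_abs, Real.norm_eq_abs, abs_of_nonneg hy'.1.1]
    exact mul_le_of_le_one_left (by positivity) hy'.1.2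
  have hρ : HasDerivAt (fun y => ((t, x + y, z + b * y + θ y * y ^ 4) : ℝ × ℝ × ℝ))
      (0, 1, b) 0 := by
    refine (hasDerivAt_const (0 : ℝ) t).prodMk (((hasDerivAt_id (0 : ℝ)).const_add x).prodMk ?_)
    exact ((((hasDerivAt_id (0 : ℝ)).const_mul b).const_add z).add hθ').congr_deriv (by simp)
  have hρ0 : ((t, x + 0, z + b * 0 + θ 0 * 0 ^ 4) : ℝ × ℝ × ℝ) = (t, x, z) := by simp
  have hgρ := HasFDerivAt.comp_hasDerivAt (l := g)
    (f := fun y => ((t, x + y, z + b * y + θ y * y ^ 4) : ℝ × ℝ × ℝ)) (0 : ℝ)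
    (by rw [hρ0]; exact hgd.hasFDerivAt) hρ
  refine (hasDerivAt_iff_tendsto_slope_zero.1 hgρ).congr' ?_
  filter_upwards [self_mem_nhdsWithin, hθ.filter_mono nhdsWithin_le_nhds] with y hy hy'
  have hy : y ≠ 0 := hy
  rw [hy'.2]
  simp
  field_simp

namespace KawaharaEq.IsMappedBy

variable {E E' : KawaharaEq} {Φ : ℝ × ℝ × ℝ → ℝ × ℝ × ℝ} {Ω : Set (ℝ × ℝ × ℝ)}

theorem partialT_time_eq (H : E.IsMappedBy E' Φ Ω) {p : ℝ × ℝ × ℝ} {ε : ℝ}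
    (hε : Metric.ball p ε ⊆ Ω) {t x x' z z' : ℝ} (hq : (t, x, z) ∈ Metric.ball p ε)
    (hq' : (t, x', z') ∈ Metric.ball p ε) :
    (partialT Φ (t, x', z')).1 = (partialT Φ (t, x, z)).1 := by
  have key : ∀ x z : ℝ, (t, x, z) ∈ Metric.ball p ε →
      HasDerivAt (fun τ => (Φ (τ, x, z)).1) (partialT Φ (t, x, z)).1 t := fun x z hq =>
    HasFDerivAt.comp_hasDerivAt (l := Prod.fst) (l' := ContinuousLinearMap.fst ℝ ℝ (ℝ × ℝ)) t
      hasFDerivAt_fst (H.hasDerivAt_slice_time (hε hq))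
  have hin : ∀ x z : ℝ, (t, x, z) ∈ Metric.ball p ε →
      ∀ᶠ τ in 𝓝 t, (τ, x, z) ∈ Metric.ball p ε := fun x z hq =>
    (by fun_prop : Continuous fun τ : ℝ => ((τ, x, z) : ℝ × ℝ × ℝ)).continuousAt.eventually_mem
      (Metric.isOpen_ball.mem_nhds hq)
  refine (key x' z' hq').unique ((key x z hq).congr_of_eventuallyEq ?_)
  filter_upwards [hin x z hq, hin x' z' hq'] with τ h1 h2
  exact H.time_eq hε h1 h2

theorem partialX_space_eq (H : E.IsMappedBy E' Φ Ω) {p : ℝ × ℝ × ℝ} {ε : ℝ}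
    (hε : Metric.ball p ε ⊆ Ω) {t x x' z z' : ℝ} (hq : (t, x, z) ∈ Metric.ball p ε)
    (hq' : (t, x', z') ∈ Metric.ball p ε) :
    (partialX Φ (t, x', z')).2.1 = (partialX Φ (t, x, z)).2.1 := by
  have h1 := H.pow_five_mul_σ (hε hq)
  have h2 := H.pow_five_mul_σ (hε hq')
  rw [H.time_eq hε hq hq', H.partialT_time_eq hε hq hq', ← h1] at h2
  have hodd : Odd 5 := by decide
  exact hodd.strictMono_pow.injective (mul_right_cancel₀ (H.σ_ne_zero (hε hq)) h2)

/-- In a time slice the new space variable is an affine function of the old one. -/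
theorem space_eq (H : E.IsMappedBy E' Φ Ω) {p : ℝ × ℝ × ℝ} {ε : ℝ}
    (hε : Metric.ball p ε ⊆ Ω) {t x x' z z' : ℝ} (hq : (t, x, z) ∈ Metric.ball p ε)
    (hq' : (t, x', z') ∈ Metric.ball p ε) :
    (Φ (t, x', z')).2.1 = (Φ (t, x, z)).2.1 + (partialX Φ (t, x, z)).2.1 * (x' - x) := by
  obtain ⟨θ, -, hθ, h⟩ := exists_mean_value_slice (f := fun q => (Φ q).2.1)
    (fun r hr => (H.differentiableAt (hε hr)).snd.fst) hq hq'
  rw [fderiv_snd_fst_apply (H.differentiableAt (hε hθ)), H.partialU_space_eq_zero (hε hθ),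
    H.partialX_space_eq hε hq hθ] at h
  linarith

theorem eventually_slice_mem {u : ℝ → ℝ → ℝ} {t x z ε : ℝ} (hε : 0 < ε) (hz : u t x = z)
    (hu : Continuous (u t)) : ∀ᶠ y in 𝓝 x, (t, y, u t y) ∈ Metric.ball (t, x, z) ε := by
  have hc : Continuous fun y : ℝ => ((t, y, u t y) : ℝ × ℝ × ℝ) := by fun_prop
  exact hc.continuousAt.eventually_mem (Metric.isOpen_ball.mem_nhds
    (by rw [hz]; exact Metric.mem_ball_self hε))

/-- A transform in a time slice. -/
theorem transform_slice (H : E.IsMappedBy E' Φ Ω) {t x z ε : ℝ} (hε0 : 0 < ε)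
    (hε : Metric.ball (t, x, z) ε ⊆ Ω) {u v : ℝ → ℝ → ℝ} (hz : u t x = z) (hu : Continuous (u t))
    (h : TransformsGraphNear Φ u v t x) :
    ∀ᶠ y in 𝓝 x, v (Φ (t, x, z)).1 ((partialX Φ (t, x, z)).2.1 * y
      + ((Φ (t, x, z)).2.1 - (partialX Φ (t, x, z)).2.1 * x)) = (Φ (t, y, u t y)).2.2 := by
  have hc : Tendsto (fun y : ℝ => ((t, y) : ℝ × ℝ)) (𝓝 x) (𝓝 (t, x)) :=
    (by fun_prop : Continuous fun y : ℝ => ((t, y) : ℝ × ℝ)).tendsto x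
  filter_upwards [eventually_slice_mem hε0 hz hu, hc.eventually h] with y hy hy'
  rw [← hy', H.time_eq hε (Metric.mem_ball_self hε0) hy,
    H.space_eq hε (Metric.mem_ball_self hε0) hy]
  congr 1
  ring

theorem contDiffAt_partialU (H : E.IsMappedBy E' Φ Ω) {p : ℝ × ℝ × ℝ} (hp : p ∈ Ω) :
    ContDiffAt ℝ ∞ (partialU Φ) p := by
  have h1 : ContDiffAt ℝ ∞ (fderiv ℝ Φ) p :=
    (H.isPointTransformation.contDiffAt hp).fderiv_right (by simp)
  exact h1.clm_apply contDiffAt_const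

/-- The new unknown function is affine in the old one, with a factor that depends on time only. -/
theorem fderiv_partialU_eq_zero (H : E.IsMappedBy E' Φ Ω) {t x z : ℝ} (hp : (t, x, z) ∈ Ω) (b : ℝ) :
    fderiv ℝ (fun q => (partialU Φ q).2.2) (t, x, z) (0, 1, b) = 0 := by
  have hΦ := H.isPointTransformation
  obtain ⟨hXT, hUT⟩ := H.partial_time_eq_zero hp
  have hT := H.partialT_time_ne_zero hp
  have hX1 := H.partialX_space_ne_zero hp
  have hUX := H.partialU_space_eq_zero hp
  have hE : -(E.α t * z ^ E.n * b) + E.α t * z ^ E.n * b + 6 * E.β t * 0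
      + 120 * E.σ t * 0 = 0 := by ring
  set a := -(E.α t * z ^ E.n * b)
  have hD : (partialT Φ (t, x, z) + a • partialU Φ (t, x, z)).1
        * (partialX Φ (t, x, z) + b • partialU Φ (t, x, z)).2.1
      - (partialX Φ (t, x, z) + b • partialU Φ (t, x, z)).1
        * (partialT Φ (t, x, z) + a • partialU Φ (t, x, z)).2.1
      = (partialT Φ (t, x, z)).1 * (partialX Φ (t, x, z)).2.1 := by
    simp [hXT, hUT, hUX]
  have hD0 := mul_ne_zero hT hX1
  obtain ⟨v₁, -, hv₁, htr₁, -⟩ := hΦ.exists_jet_transform hp 0 0 0 0 hD hD0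
  obtain ⟨v₂, -, hv₂, htr₂, -⟩ := hΦ.exists_jet_transform hp 0 1 0 0 hD hD0
  obtain ⟨A₁, B₁⟩ := htr₁.first_order (jetFunction_self ..) (H.differentiableAt hp)
    (hasFDerivAt_jetFunction ..) hv₁
  obtain ⟨A₂, B₂⟩ := htr₂.first_order (jetFunction_self ..) (H.differentiableAt hp)
    (hasFDerivAt_jetFunction ..) hv₂
  have q₁ := H.equation_of_jet hp hv₁ htr₁ hE
  have q₂ := H.equation_of_jet hp hv₂ htr₂ hE
  have hX : deriv (fun y => v₂ (Φ (t, x, z)).1 y) (Φ (t, x, z)).2.1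
      = deriv (fun y => v₁ (Φ (t, x, z)).1 y) (Φ (t, x, z)).2.1 := by
    have := B₂.trans B₁.symm
    simpa [hXT, hUT, hUX, hX1] using this
  have hTT : deriv (fun s => v₂ s (Φ (t, x, z)).2.1) (Φ (t, x, z)).1
      = deriv (fun s => v₁ s (Φ (t, x, z)).2.1) (Φ (t, x, z)).1 := by
    have := A₂.trans A₁.symm
    simpa [hXT, hUT, hUX, hX, hT] using this
  obtain ⟨ε, hε0, hε⟩ := H.exists_ball hp
  have hcont : ∀ c₄ : ℝ, Continuous (jetFunction t x z a b 0 c₄ 0 0 t) := by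
    intro c₄; unfold jetFunction; fun_prop
  have s₁ := H.transform_slice hε0 hε (jetFunction_self ..) (hcont 0) htr₁
  have s₂ := H.transform_slice hε0 hε (jetFunction_self ..) (hcont 1) htr₂
  set T₀ := (Φ (t, x, z)).1
  set X₀ := (Φ (t, x, z)).2.1
  set m := (partialX Φ (t, x, z)).2.1
  set K := (partialU Φ (t, x, z)).2.2 with hK
  have hlim := tendsto_quartic_increment (f := fun q => (Φ q).2.2)
    (g := fun q => (partialU Φ q).2.2) (b := b) hε0
    (fun r hr => (H.differentiableAt (hε hr)).snd.snd)
    (fun r hr => by rw [fderiv_snd_snd_apply (H.differentiableAt (hε hr))]; simp)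
    ((H.contDiffAt_partialU hp).differentiableAt (by simp)).snd.snd
  set Q := fderiv ℝ (fun q => (partialU Φ q).2.2) (t, x, z) (0, 1, b)
  let ψ : (ℝ → ℝ → ℝ) → ℝ → ℝ := fun v y => v T₀ (m * y + X₀)
  have hψC : ∀ v : ℝ → ℝ → ℝ, ContDiffAt ℝ ∞ (fun q : ℝ × ℝ => v q.1 q.2) (T₀, X₀) →
      ContDiffAt ℝ ∞ (ψ v) 0 := by
    intro v hv
    exact ContDiffAt.comp (0 : ℝ) (f := fun y : ℝ => m * y + X₀) (by simpa using hv.slice)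
      (by fun_prop)
  have hquart : ContDiffAt ℝ ∞ (fun y => jetFunction 0 0 0 0 0 0 K 0 0 0 y) (0 : ℝ) := by
    unfold jetFunction; fun_prop
  have hshift : Tendsto (fun y : ℝ => x + y) (𝓝 0) (𝓝 x) :=
    (by fun_prop : Continuous fun y : ℝ => x + y).tendsto' 0 x (by simp)
  have hev : (fun y => (ψ v₂ y - ψ v₁ y - jetFunction 0 0 0 0 0 0 K 0 0 0 y) / y ^ 5) =ᶠ[𝓝[≠] 0]
      fun y => ((Φ (t, x + y, z + b * y + y ^ 4)).2.2 - (Φ (t, x + y, z + b * y)).2.2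
        - K * y ^ 4) / y ^ 5 := by
    filter_upwards [(hshift.eventually s₁).filter_mono nhdsWithin_le_nhds,
      (hshift.eventually s₂).filter_mono nhdsWithin_le_nhds] with y h1 h2
    have e : m * (x + y) + (X₀ - m * x) = m * y + X₀ := by ring
    rw [e] at h1 h2
    simp only [ψ, h1, h2]
    simp [jetFunction]
  have hlim' := hlim.congr' hev.symm
  obtain ⟨hlow, htop⟩ := iteratedDeriv_of_tendsto_div_pow
    (((hψC v₂ hv₂).sub (hψC v₁ hv₁)).sub hquart) hlim'
  have h3 := hlow 3 (by norm_num)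
  have hle : ∀ k : ℕ, (k : ℕ∞ω) ≤ ∞ := fun k => by exact_mod_cast le_top
  have hsub : ∀ k, iteratedDeriv k
      (fun y => ψ v₂ y - ψ v₁ y - jetFunction 0 0 0 0 0 0 K 0 0 0 y) 0
      = m ^ k * (iteratedDeriv k (fun y => v₂ T₀ y) X₀ - iteratedDeriv k (fun y => v₁ T₀ y) X₀)
        - iteratedDeriv k (fun y => jetFunction 0 0 0 0 0 0 K 0 0 0 y) 0 := by
    intro k
    rw [iteratedDeriv_fun_sub (((hψC v₂ hv₂).sub (hψC v₁ hv₁)).of_le (hle k)) (hquart.of_le (hle k)),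
      iteratedDeriv_fun_sub ((hψC v₂ hv₂).of_le (hle k)) ((hψC v₁ hv₁).of_le (hle k))]
    have e : ∀ v : ℝ → ℝ → ℝ, iteratedDeriv k (ψ v) 0
        = m ^ k * iteratedDeriv k (fun y => v T₀ y) X₀ := by
      intro v
      have := iteratedDeriv_of_eventuallyEq_comp_affine (f := ψ v) (g := fun y => v T₀ y)
        (c := m) (d := X₀) (x := 0) (Eventually.of_forall fun y => rfl) k
      rw [← this, mul_zero, zero_add]
    rw [e, e]
    ring
  rw [hsub, iteratedDeriv_three_jetFunction] at h3
  rw [hsub, iteratedDeriv_five_jetFunction] at htop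
  have h3' : iteratedDeriv 3 (fun y => v₂ T₀ y) X₀ = iteratedDeriv 3 (fun y => v₁ T₀ y) X₀ := by
    have := pow_ne_zero 3 hX1
    simp only [mul_zero, sub_zero] at h3
    exact sub_eq_zero.1 ((mul_eq_zero.1 h3).resolve_left this)
  rw [hX, hTT, h3'] at q₂
  have h5 : iteratedDeriv 5 (fun y => v₂ T₀ y) X₀ - iteratedDeriv 5 (fun y => v₁ T₀ y) X₀ = 0 := by
    have : E'.σ T₀ * (iteratedDeriv 5 (fun y => v₂ T₀ y) X₀
        - iteratedDeriv 5 (fun y => v₁ T₀ y) X₀) = 0 := by linarith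
    exact (mul_eq_zero.1 this).resolve_left (H.σ_ne_zero' hp)
  rw [h5] at htop
  have h120 : ((Nat.factorial 5 : ℕ) : ℝ) ≠ 0 := by positivity
  have : ((Nat.factorial 5 : ℕ) : ℝ) * Q = 0 := by rw [← htop]; ring
  exact (mul_eq_zero.1 this).resolve_left h120

theorem partialU_unknown_eq (H : E.IsMappedBy E' Φ Ω) {p : ℝ × ℝ × ℝ} {ε : ℝ}
    (hε : Metric.ball p ε ⊆ Ω) {t x x' z z' : ℝ} (hq : (t, x, z) ∈ Metric.ball p ε)
    (hq' : (t, x', z') ∈ Metric.ball p ε) :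
    (partialU Φ (t, x', z')).2.2 = (partialU Φ (t, x, z)).2.2 := by
  obtain ⟨θ, -, hθ, h⟩ := exists_mean_value_slice (f := fun q => (partialU Φ q).2.2)
    (fun r hr => ((H.contDiffAt_partialU (hε hr)).differentiableAt (by simp)).snd.snd) hq hq'
  have h0 := H.fderiv_partialU_eq_zero (hε hθ) 0
  have h1 := H.fderiv_partialU_eq_zero (hε hθ) 1
  have e : ((0, x' - x, z' - z) : ℝ × ℝ × ℝ)
      = (x' - x - (z' - z)) • (0, 1, 0) + (z' - z) • (0, 1, 1) := by simp
  rw [e, map_add, map_smul, map_smul, h0, h1] at h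
  simp at h
  linarith

theorem unknown_eq (H : E.IsMappedBy E' Φ Ω) {p : ℝ × ℝ × ℝ} {ε : ℝ}
    (hε : Metric.ball p ε ⊆ Ω) {t x x' z z' z'' : ℝ} (hq : (t, x, z) ∈ Metric.ball p ε)
    (hq' : (t, x', z') ∈ Metric.ball p ε) (hq'' : (t, x', z'') ∈ Metric.ball p ε) :
    (Φ (t, x', z'')).2.2 = (Φ (t, x', z')).2.2 + (partialU Φ (t, x, z)).2.2 * (z'' - z') := by
  obtain ⟨θ, -, hθ, h⟩ := exists_mean_value_slice (f := fun q => (Φ q).2.2)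
    (fun r hr => (H.differentiableAt (hε hr)).snd.snd) hq' hq''
  rw [fderiv_snd_snd_apply (H.differentiableAt (hε hθ)), H.partialU_unknown_eq hε hq hθ] at h
  linarith

/-- The equation in terms of the jet of the original function. -/
theorem determining_polynomial (H : E.IsMappedBy E' Φ Ω) {t x z : ℝ} (hp : (t, x, z) ∈ Ω)
    (b c₃ c₅ : ℝ) {T' m K a : ℝ} (hT' : (partialT Φ (t, x, z)).1 = T')
    (hm : (partialX Φ (t, x, z)).2.1 = m) (hK : (partialU Φ (t, x, z)).2.2 = K)
    (ha : a = -(E.α t * z ^ E.n * b + 6 * E.β t * c₃ + 120 * E.σ t * c₅)) :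
    ((partialT Φ (t, x, z)).2.2 + a * K) * m ^ 5
      - ((partialX Φ (t, x, z)).2.2 + b * K) * (partialT Φ (t, x, z)).2.1 * m ^ 4
      + T' * (E'.α (Φ (t, x, z)).1 * (Φ (t, x, z)).2.2 ^ E'.n
          * ((partialX Φ (t, x, z)).2.2 + b * K) * m ^ 4
        + E'.β (Φ (t, x, z)).1
          * (iteratedDeriv 3 (fun y => (Φ (t, y, z)).2.2) x + 6 * c₃ * K) * m ^ 2
        + E'.σ (Φ (t, x, z)).1
          * (iteratedDeriv 5 (fun y => (Φ (t, y, z)).2.2) x + 120 * c₅ * K)) = 0 := by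
  have hΦ := H.isPointTransformation
  obtain ⟨hXT, hUT⟩ := H.partial_time_eq_zero hp
  have hT := H.partialT_time_ne_zero hp
  have hX1 := H.partialX_space_ne_zero hp
  have hUX := H.partialU_space_eq_zero hp
  have hE : a + E.α t * z ^ E.n * b + 6 * E.β t * c₃ + 120 * E.σ t * c₅ = 0 := by rw [ha]; ring
  have hD : (partialT Φ (t, x, z) + a • partialU Φ (t, x, z)).1
        * (partialX Φ (t, x, z) + b • partialU Φ (t, x, z)).2.1
      - (partialX Φ (t, x, z) + b • partialU Φ (t, x, z)).1
        * (partialT Φ (t, x, z) + a • partialU Φ (t, x, z)).2.1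
      = (partialT Φ (t, x, z)).1 * (partialX Φ (t, x, z)).2.1 := by
    simp [hXT, hUT, hUX]
  obtain ⟨v, -, hv, htr, -⟩ := hΦ.exists_jet_transform hp c₃ 0 c₅ 0 hD (mul_ne_zero hT hX1)
  obtain ⟨A, B⟩ := htr.first_order (jetFunction_self ..) (H.differentiableAt hp)
    (hasFDerivAt_jetFunction ..) hv
  have q := H.equation_of_jet hp hv htr hE
  obtain ⟨ε, hε0, hε⟩ := H.exists_ball hp
  have hcont : Continuous (jetFunction t x z a b c₃ 0 c₅ 0 t) := by
    unfold jetFunction; fun_prop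
  have hs := H.transform_slice hε0 hε (jetFunction_self ..) hcont htr
  set f : ℝ → ℝ := fun y => (Φ (t, y, z)).2.2 with hf
  have hfC : ContDiffAt ℝ ∞ f x :=
    ContDiffAt.comp x (f := fun y : ℝ => ((t, y, z) : ℝ × ℝ × ℝ))
      (g := fun q => (Φ q).2.2) (hΦ.contDiffAt hp).snd.snd (by fun_prop)
  have hjC : ContDiffAt ℝ ∞ (fun y => jetFunction t x z a b c₃ 0 c₅ 0 t y) x := by
    unfold jetFunction; fun_prop
  have hev : ∀ᶠ y in 𝓝 x, v (Φ (t, x, z)).1 ((partialX Φ (t, x, z)).2.1 * y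
      + ((Φ (t, x, z)).2.1 - (partialX Φ (t, x, z)).2.1 * x))
      = f y + K * (jetFunction t x z a b c₃ 0 c₅ 0 t y - z) := by
    filter_upwards [hs, eventually_slice_mem hε0 (jetFunction_self ..) hcont,
      eventually_slice_mem (u := fun _ _ => z) (t := t) hε0 rfl continuous_const] with y h1 h2 h3
    rw [h1, H.unknown_eq hε (Metric.mem_ball_self hε0) h3 h2, hK]
  have hle : ∀ k : ℕ, (k : ℕ∞ω) ≤ ∞ := fun k => by exact_mod_cast le_top
  have hk : ∀ k : ℕ, 0 < k → m ^ k * iteratedDeriv k (fun y => v (Φ (t, x, z)).1 y) (Φ (t, x, z)).2.1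
      = iteratedDeriv k f x
        + K * iteratedDeriv k (fun y => jetFunction t x z a b c₃ 0 c₅ 0 t y) x := by
    intro k hk0
    have h1 := iteratedDeriv_of_eventuallyEq_comp_affine (g := fun y => v (Φ (t, x, z)).1 y) hev k
    rw [add_sub_cancel, hm] at h1
    rw [h1, iteratedDeriv_fun_add (hfC.of_le (hle k))
      ((contDiffAt_const.mul (hjC.sub contDiffAt_const)).of_le (hle k)),
      iteratedDeriv_const_mul_field]
    congr 2
    rw [iteratedDeriv_fun_sub (hjC.of_le (hle k)) contDiffAt_const, iteratedDeriv_const,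
      if_neg hk0.ne', sub_zero]
  have k3 := hk 3 (by norm_num)
  have k5 := hk 5 (by norm_num)
  rw [iteratedDeriv_three_jetFunction] at k3
  rw [iteratedDeriv_five_jetFunction] at k5
  simp [hXT, hUT, hUX, hT', hm, hK] at A B
  set vX := deriv (fun y => v (Φ (t, x, z)).1 y) (Φ (t, x, z)).2.1
  set vT := deriv (fun s => v s (Φ (t, x, z)).2.1) (Φ (t, x, z)).1
  linear_combination T' * m ^ 5 * q - m ^ 5 * A + ((partialT Φ (t, x, z)).2.1 * m ^ 4
    - T' * E'.α (Φ (t, x, z)).1 * (Φ (t, x, z)).2.2 ^ E'.n * m ^ 4) * B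
    - T' * E'.β (Φ (t, x, z)).1 * m ^ 2 * k3 - T' * E'.σ (Φ (t, x, z)).1 * k5

theorem pow_three_mul_β (H : E.IsMappedBy E' Φ Ω) {t x z : ℝ} (hp : (t, x, z) ∈ Ω) :
    (partialX Φ (t, x, z)).2.1 ^ 3 * E.β t
      = E'.β (Φ (t, x, z)).1 * (partialT Φ (t, x, z)).1 := by
  have h0 := H.determining_polynomial hp 0 0 0 rfl rfl rfl rfl
  have h1 := H.determining_polynomial hp 0 1 0 rfl rfl rfl rfl
  have hm := pow_ne_zero 2 (H.partialX_space_ne_zero hp)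
  have hK := H.partialU_unknown_ne_zero hp
  refine mul_right_cancel₀ (mul_ne_zero hm hK) ?_
  linear_combination 1 / 6 * h0 - 1 / 6 * h1

theorem α_relation (H : E.IsMappedBy E' Φ Ω) {t x z : ℝ} (hp : (t, x, z) ∈ Ω) :
    E'.α (Φ (t, x, z)).1 * (partialT Φ (t, x, z)).1 * (Φ (t, x, z)).2.2 ^ E'.n
      = E.α t * (partialX Φ (t, x, z)).2.1 * z ^ E.n + (partialT Φ (t, x, z)).2.1 := by
  have h0 := H.determining_polynomial hp 0 0 0 rfl rfl rfl rfl
  have h1 := H.determining_polynomial hp 1 0 0 rfl rfl rfl rfl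
  have hm := pow_ne_zero 4 (H.partialX_space_ne_zero hp)
  have hK := H.partialU_unknown_ne_zero hp
  refine mul_right_cancel₀ (mul_ne_zero hm hK) ?_
  linear_combination h1 - h0

theorem source_relation (H : E.IsMappedBy E' Φ Ω) {t x z : ℝ} (hp : (t, x, z) ∈ Ω) :
    (partialT Φ (t, x, z)).2.2 + E.α t * z ^ E.n * (partialX Φ (t, x, z)).2.2
      + E.β t * iteratedDeriv 3 (fun y => (Φ (t, y, z)).2.2) x
      + E.σ t * iteratedDeriv 5 (fun y => (Φ (t, y, z)).2.2) x = 0 := by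
  have h0 := H.determining_polynomial hp 0 0 0 rfl rfl rfl rfl
  have hm := pow_ne_zero 5 (H.partialX_space_ne_zero hp)
  have hα := H.α_relation hp
  have hβ := H.pow_three_mul_β hp
  have hσ := H.pow_five_mul_σ hp
  refine (mul_eq_zero.1 (?_ : (partialX Φ (t, x, z)).2.1 ^ 5 * _ = 0)).resolve_left hm
  linear_combination h0 - (partialX Φ (t, x, z)).2.2 * (partialX Φ (t, x, z)).2.1 ^ 4 * hα
    + iteratedDeriv 3 (fun y => (Φ (t, y, z)).2.2) x * (partialX Φ (t, x, z)).2.1 ^ 2 * hβ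
    + iteratedDeriv 5 (fun y => (Φ (t, y, z)).2.2) x * hσ

end KawaharaEq.IsMappedBy

theorem eventually_prodMk_time_mem {S : Set (ℝ × ℝ × ℝ)} (hS : IsOpen S) {t x z : ℝ}
    (h : (t, x, z) ∈ S) : ∀ᶠ τ in 𝓝 t, (τ, x, z) ∈ S :=
  (by fun_prop : Continuous fun τ : ℝ => ((τ, x, z) : ℝ × ℝ × ℝ)).continuousAt.eventually_mem
    (hS.mem_nhds h)

theorem eventually_prodMk_space_mem {S : Set (ℝ × ℝ × ℝ)} (hS : IsOpen S) {t x z : ℝ}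
    (h : (t, x, z) ∈ S) : ∀ᶠ y in 𝓝 x, (t, y, z) ∈ S :=
  (by fun_prop : Continuous fun y : ℝ => ((t, y, z) : ℝ × ℝ × ℝ)).continuousAt.eventually_mem
    (hS.mem_nhds h)

theorem eventually_prodMk_unknown_mem {S : Set (ℝ × ℝ × ℝ)} (hS : IsOpen S) {t x z : ℝ}
    (h : (t, x, z) ∈ S) : ∀ᶠ w in 𝓝 z, (t, x, w) ∈ S :=
  (by fun_prop : Continuous fun w : ℝ => ((t, x, w) : ℝ × ℝ × ℝ)).continuousAt.eventually_mem
    (hS.mem_nhds h)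

theorem eqOn_ball_of_hasDerivAt_zero {f : ℝ → ℝ} {t₀ ε : ℝ}
    (h : ∀ t, |t - t₀| < ε → HasDerivAt f 0 t) {t : ℝ} (ht : |t - t₀| < ε) : f t = f t₀ := by
  have h0 : |t₀ - t₀| < ε := by simpa using (abs_nonneg _).trans_lt ht
  refine (convex_ball t₀ ε).is_const_of_fderivWithin_eq_zero (𝕜 := ℝ) (f := f)
    (fun s hs => (h s (by simpa [Real.dist_eq] using hs)).differentiableAt.differentiableWithinAt)
    (fun s hs => ?_) (by simpa [Real.dist_eq] using ht) (by simpa [Real.dist_eq] using h0)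
  have hs' := h s (by simpa [Real.dist_eq] using hs)
  rw [fderivWithin_of_isOpen Metric.isOpen_ball hs, hs'.hasFDerivAt.fderiv]
  ext; simp

namespace KawaharaEq.IsMappedBy

variable {E E' : KawaharaEq} {Φ : ℝ × ℝ × ℝ → ℝ × ℝ × ℝ} {Ω : Set (ℝ × ℝ × ℝ)}

theorem contDiffAt_partialX (H : E.IsMappedBy E' Φ Ω) {p : ℝ × ℝ × ℝ} (hp : p ∈ Ω) :
    ContDiffAt ℝ ∞ (partialX Φ) p := by
  have h1 : ContDiffAt ℝ ∞ (fderiv ℝ Φ) p :=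
    (H.isPointTransformation.contDiffAt hp).fderiv_right (by simp)
  exact h1.clm_apply contDiffAt_const

theorem hasDerivAt_slope (H : E.IsMappedBy E' Φ Ω) {t x z : ℝ} (hp : (t, x, z) ∈ Ω) :
    HasDerivAt (fun τ => (partialX Φ (τ, x, z)).2.1)
      (deriv (fun τ => (partialX Φ (τ, x, z)).2.1) t) t := by
  have h : ContDiffAt ℝ ∞ (fun τ => (partialX Φ (τ, x, z)).2.1) t :=
    ContDiffAt.comp t (f := fun τ : ℝ => ((τ, x, z) : ℝ × ℝ × ℝ))
      (g := fun q => (partialX Φ q).2.1) (H.contDiffAt_partialX hp).snd.fst (by fun_prop)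
  exact (h.differentiableAt (by simp)).hasDerivAt

theorem hasDerivAt_factor (H : E.IsMappedBy E' Φ Ω) {t x z : ℝ} (hp : (t, x, z) ∈ Ω) :
    HasDerivAt (fun τ => (partialU Φ (τ, x, z)).2.2)
      (deriv (fun τ => (partialU Φ (τ, x, z)).2.2) t) t := by
  have h : ContDiffAt ℝ ∞ (fun τ => (partialU Φ (τ, x, z)).2.2) t :=
    ContDiffAt.comp t (f := fun τ : ℝ => ((τ, x, z) : ℝ × ℝ × ℝ))
      (g := fun q => (partialU Φ q).2.2) (H.contDiffAt_partialU hp).snd.snd (by fun_prop)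
  exact (h.differentiableAt (by simp)).hasDerivAt

theorem hasDerivAt_space_time (H : E.IsMappedBy E' Φ Ω) {t x z : ℝ} (hp : (t, x, z) ∈ Ω) :
    HasDerivAt (fun τ => (Φ (τ, x, z)).2.1) (partialT Φ (t, x, z)).2.1 t :=
  HasFDerivAt.comp_hasDerivAt (l := fun q : ℝ × ℝ × ℝ => q.2.1)
    (l' := (ContinuousLinearMap.fst ℝ ℝ ℝ).comp (ContinuousLinearMap.snd ℝ ℝ (ℝ × ℝ))) t
    (hasFDerivAt_fst.comp _ hasFDerivAt_snd) (H.hasDerivAt_slice_time hp)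

theorem hasDerivAt_unknown_time (H : E.IsMappedBy E' Φ Ω) {t x z : ℝ} (hp : (t, x, z) ∈ Ω) :
    HasDerivAt (fun τ => (Φ (τ, x, z)).2.2) (partialT Φ (t, x, z)).2.2 t :=
  HasFDerivAt.comp_hasDerivAt (l := fun q : ℝ × ℝ × ℝ => q.2.2)
    (l' := (ContinuousLinearMap.snd ℝ ℝ ℝ).comp (ContinuousLinearMap.snd ℝ ℝ (ℝ × ℝ))) t
    (hasFDerivAt_snd.comp _ hasFDerivAt_snd) (H.hasDerivAt_slice_time hp)

theorem hasDerivAt_unknown_space (H : E.IsMappedBy E' Φ Ω) {t x z : ℝ} (hp : (t, x, z) ∈ Ω) :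
    HasDerivAt (fun y => (Φ (t, y, z)).2.2) (partialX Φ (t, x, z)).2.2 x :=
  HasFDerivAt.comp_hasDerivAt (l := fun q : ℝ × ℝ × ℝ => q.2.2)
    (l' := (ContinuousLinearMap.snd ℝ ℝ ℝ).comp (ContinuousLinearMap.snd ℝ ℝ (ℝ × ℝ))) x
    (hasFDerivAt_snd.comp _ hasFDerivAt_snd)
    (HasFDerivAt.comp_hasDerivAt (l := Φ) x (H.isPointTransformation.hasFDerivAt hp)
      ((hasDerivAt_const x t).prodMk ((hasDerivAt_id x).prodMk (hasDerivAt_const x z))))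

theorem partialT_space_eq (H : E.IsMappedBy E' Φ Ω) {p : ℝ × ℝ × ℝ} {ε : ℝ}
    (hε : Metric.ball p ε ⊆ Ω) {t x x' z z' : ℝ} (hq : (t, x, z) ∈ Metric.ball p ε)
    (hq' : (t, x', z') ∈ Metric.ball p ε) :
    (partialT Φ (t, x', z')).2.1 = (partialT Φ (t, x, z)).2.1
      + deriv (fun τ => (partialX Φ (τ, x, z)).2.1) t * (x' - x) := by
  refine (H.hasDerivAt_space_time (hε hq')).unique
    (((H.hasDerivAt_space_time (hε hq)).add
      ((H.hasDerivAt_slope (hε hq)).mul_const (x' - x))).congr_of_eventuallyEq ?_)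
  filter_upwards [eventually_prodMk_time_mem Metric.isOpen_ball hq,
    eventually_prodMk_time_mem Metric.isOpen_ball hq'] with τ h1 h2
  exact H.space_eq hε h1 h2

theorem partialT_unknown_eq (H : E.IsMappedBy E' Φ Ω) {p : ℝ × ℝ × ℝ} {ε : ℝ}
    (hε : Metric.ball p ε ⊆ Ω) {t x z z' : ℝ} (hq : (t, x, z) ∈ Metric.ball p ε)
    (hq' : (t, x, z') ∈ Metric.ball p ε) :
    (partialT Φ (t, x, z')).2.2 = (partialT Φ (t, x, z)).2.2
      + deriv (fun τ => (partialU Φ (τ, x, z)).2.2) t * (z' - z) := by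
  refine (H.hasDerivAt_unknown_time (hε hq')).unique
    (((H.hasDerivAt_unknown_time (hε hq)).add
      ((H.hasDerivAt_factor (hε hq)).mul_const (z' - z))).congr_of_eventuallyEq ?_)
  filter_upwards [eventually_prodMk_time_mem Metric.isOpen_ball hq,
    eventually_prodMk_time_mem Metric.isOpen_ball hq'] with τ h1 h2
  exact H.unknown_eq hε h1 h1 h2

theorem iteratedDeriv_unknown_eq (H : E.IsMappedBy E' Φ Ω) {p : ℝ × ℝ × ℝ} {ε : ℝ}
    (hε : Metric.ball p ε ⊆ Ω) {t x z z' : ℝ} (hq : (t, x, z) ∈ Metric.ball p ε)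
    (hq' : (t, x, z') ∈ Metric.ball p ε) {k : ℕ} (hk : 0 < k) :
    iteratedDeriv k (fun y => (Φ (t, y, z')).2.2) x
      = iteratedDeriv k (fun y => (Φ (t, y, z)).2.2) x := by
  have h : (fun y => (Φ (t, y, z')).2.2) =ᶠ[𝓝 x]
      fun y => (partialU Φ (t, x, z)).2.2 * (z' - z) + (Φ (t, y, z)).2.2 := by
    filter_upwards [eventually_prodMk_space_mem Metric.isOpen_ball hq,
      eventually_prodMk_space_mem Metric.isOpen_ball hq'] with y h1 h2
    rw [H.unknown_eq hε hq h1 h2, add_comm]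
  rw [h.iteratedDeriv_eq, iteratedDeriv_const_add hk]

theorem partialX_unknown_eq (H : E.IsMappedBy E' Φ Ω) {p : ℝ × ℝ × ℝ} {ε : ℝ}
    (hε : Metric.ball p ε ⊆ Ω) {t x z z' : ℝ} (hq : (t, x, z) ∈ Metric.ball p ε)
    (hq' : (t, x, z') ∈ Metric.ball p ε) :
    (partialX Φ (t, x, z')).2.2 = (partialX Φ (t, x, z)).2.2 := by
  have := H.iteratedDeriv_unknown_eq hε hq hq' one_pos
  simpa [iteratedDeriv_one, (H.hasDerivAt_unknown_space (hε hq)).deriv,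
    (H.hasDerivAt_unknown_space (hε hq')).deriv] using this

/-- The part of the determining equations that is free of derivatives of the unknown function. -/
theorem eventually_source (H : E.IsMappedBy E' Φ Ω) {t x z : ℝ} (hp : (t, x, z) ∈ Ω) :
    ∀ᶠ w in 𝓝 z, (partialT Φ (t, x, z)).2.2
      + deriv (fun τ => (partialU Φ (τ, x, z)).2.2) t * (w - z)
      + E.α t * w ^ E.n * (partialX Φ (t, x, z)).2.2
      + E.β t * iteratedDeriv 3 (fun y => (Φ (t, y, z)).2.2) x
      + E.σ t * iteratedDeriv 5 (fun y => (Φ (t, y, z)).2.2) x = 0 := by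
  obtain ⟨ε, hε0, hε⟩ := H.exists_ball hp
  have h0 := Metric.mem_ball_self (x := (t, x, z)) hε0
  filter_upwards [eventually_prodMk_unknown_mem Metric.isOpen_ball h0] with w hw
  have := H.source_relation (hε hw)
  rwa [H.partialT_unknown_eq hε h0 hw, H.partialX_unknown_eq hε h0 hw,
    H.iteratedDeriv_unknown_eq hε h0 hw (by norm_num : 0 < 3),
    H.iteratedDeriv_unknown_eq hε h0 hw (by norm_num : 0 < 5)] at this

theorem α_ne_zero (H : E.IsMappedBy E' Φ Ω) {t x z : ℝ} (hp : (t, x, z) ∈ Ω) : E.α t ≠ 0 :=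
  E.α_ne_zero _ (H.subset_domain hp).1

theorem partialX_unknown_eq_zero (H : E.IsMappedBy E' Φ Ω) (hn : E.n ≠ 1) {t x z : ℝ}
    (hp : (t, x, z) ∈ Ω) : (partialX Φ (t, x, z)).2.2 = 0 := by
  obtain ⟨-, -, h⟩ := eq_zero_of_eventually_affine_add_zpow
    (A := (partialT Φ (t, x, z)).2.2 - deriv (fun τ => (partialU Φ (τ, x, z)).2.2) t * z
      + E.β t * iteratedDeriv 3 (fun y => (Φ (t, y, z)).2.2) x
      + E.σ t * iteratedDeriv 5 (fun y => (Φ (t, y, z)).2.2) x)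
    (B := deriv (fun τ => (partialU Φ (τ, x, z)).2.2) t)
    (C := E.α t * (partialX Φ (t, x, z)).2.2) E.n_ne_zero hn (by
      filter_upwards [H.eventually_source hp] with w hw
      linarith)
  exact (mul_eq_zero.1 h).resolve_left (H.α_ne_zero hp)

theorem partialT_unknown_eq_zero (H : E.IsMappedBy E' Φ Ω) (hn : E.n ≠ 1) {t x z : ℝ}
    (hp : (t, x, z) ∈ Ω) : (partialT Φ (t, x, z)).2.2 = 0 := by
  have hd : deriv (fun y => (Φ (t, y, z)).2.2) =ᶠ[𝓝 x] fun _ => (0 : ℝ) := by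
    filter_upwards [eventually_prodMk_space_mem H.isPointTransformation.isOpen hp] with y hy
    rw [(H.hasDerivAt_unknown_space hy).deriv, H.partialX_unknown_eq_zero hn hy]
  have h := H.source_relation hp
  have hk : ∀ k, iteratedDeriv (k + 1) (fun y => (Φ (t, y, z)).2.2) x = 0 := by
    intro k
    rw [iteratedDeriv_succ', hd.iteratedDeriv_eq, iteratedDeriv_const, ite_self]
  rw [hk 2, hk 4, H.partialX_unknown_eq_zero hn hp] at h
  simpa using h

/-- If the nonlinearity is not quadratic, the new unknown function depends on the old one only. -/
theorem unknown_eq_of_ne_one (H : E.IsMappedBy E' Φ Ω) (hn : E.n ≠ 1) {p : ℝ × ℝ × ℝ} {ε : ℝ}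
    (hε : Metric.ball p ε ⊆ Ω) {t t' x x' z : ℝ} (hq : (t, x, z) ∈ Metric.ball p ε)
    (hq' : (t', x', z) ∈ Metric.ball p ε) : (Φ (t', x', z)).2.2 = (Φ (t, x, z)).2.2 := by
  obtain ⟨r, hr, h⟩ := domain_mvt (f := fun q => (Φ q).2.2)
    (f' := fderiv ℝ (fun q => (Φ q).2.2)) (s := Metric.ball p ε)
    (fun r hr => (H.differentiableAt (hε hr)).snd.snd.hasFDerivAt.hasFDerivWithinAt)
    (convex_ball p ε) hq hq'
  have hrΩ := hε ((convex_ball p ε).segment_subset hq hq' hr)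
  obtain ⟨r₁, r₂, r₃⟩ := r
  have e : ((t', x', z) : ℝ × ℝ × ℝ) - (t, x, z) = (t' - t, x' - x, 0) := by simp
  rw [e, fderiv_snd_snd_apply (H.differentiableAt hrΩ), H.partialT_unknown_eq_zero hn hrΩ,
    H.partialX_unknown_eq_zero hn hrΩ] at h
  simp at h
  linarith

theorem exists_mem_ball_space {t x z ε : ℝ} {t₀ x₀ z₀ : ℝ}
    (h : (t, x, z) ∈ Metric.ball ((t₀, x₀, z₀) : ℝ × ℝ × ℝ) ε) :
    ∃ x', x' ≠ x ∧ (t, x', z) ∈ Metric.ball ((t₀, x₀, z₀) : ℝ × ℝ × ℝ) ε := by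
  have h1 : ∀ᶠ y in 𝓝[≠] x, (t, y, z) ∈ Metric.ball ((t₀, x₀, z₀) : ℝ × ℝ × ℝ) ε :=
    (eventually_prodMk_space_mem Metric.isOpen_ball h).filter_mono nhdsWithin_le_nhds
  exact ((eventually_mem_nhdsWithin).and h1).exists

/-- If the nonlinearity is not quadratic, the dilation factor of space is constant. -/
theorem slope_eq_of_ne_one (H : E.IsMappedBy E' Φ Ω) (hn : E.n ≠ 1) {t₀ x₀ z₀ ε : ℝ} (hε0 : 0 < ε)
    (hε : Metric.ball (t₀, x₀, z₀) ε ⊆ Ω) {t : ℝ} (ht : |t - t₀| < ε) :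
    (partialX Φ (t, x₀, z₀)).2.1 = (partialX Φ (t₀, x₀, z₀)).2.1 := by
  refine eqOn_ball_of_hasDerivAt_zero (f := fun τ => (partialX Φ (τ, x₀, z₀)).2.1) ?_ ht
  intro s hs
  have hq : (s, x₀, z₀) ∈ Metric.ball ((t₀, x₀, z₀) : ℝ × ℝ × ℝ) ε :=
    mem_ball_triple.2 ⟨hs, by simpa using hε0, by simpa using hε0⟩
  have hd := H.hasDerivAt_slope (hε hq)
  obtain ⟨x', hx', hq'⟩ := exists_mem_ball_space hq
  have h1 := H.α_relation (hε hq)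
  have h2 := H.α_relation (hε hq')
  rw [H.time_eq hε hq hq', H.partialT_time_eq hε hq hq', H.unknown_eq_of_ne_one hn hε hq hq',
    H.partialX_space_eq hε hq hq', H.partialT_space_eq hε hq hq', h1] at h2
  have h3 : deriv (fun τ => (partialX Φ (τ, x₀, z₀)).2.1) s * (x' - x₀) = 0 := by linarith
  rw [(mul_eq_zero.1 h3).resolve_right (sub_ne_zero.2 hx')] at hd
  exact hd

theorem ratios_eq_of_ne_one (H : E.IsMappedBy E' Φ Ω) (hn : E.n ≠ 1) {a b c : ℝ}
    (hc : ∀ t ∈ E'.I, E'.α t = a ∧ E'.β t = b ∧ E'.σ t = c) {t₀ : ℝ} (ht₀ : t₀ ∈ E.I) :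
    ∀ᶠ t in 𝓝 t₀, E.β t / E.α t = E.β t₀ / E.α t₀ ∧ E.σ t / E.α t = E.σ t₀ / E.α t₀ := by
  obtain ⟨x₀, z₀, hp⟩ := H.covers_time t₀ ht₀
  obtain ⟨ε, hε0, hε⟩ := H.exists_ball hp
  have h0 := Metric.mem_ball_self (x := (t₀, x₀, z₀)) hε0
  have hc' : ∀ q ∈ Ω, E'.α (Φ q).1 = a ∧ E'.β (Φ q).1 = b ∧ E'.σ (Φ q).1 = c :=
    fun q hq => hc _ (H.mapsTo_domain hq).1
  obtain ⟨z₁, hz, hz₁⟩ : ∃ z₁, z₁ ^ E.n ≠ z₀ ^ E.n ∧ |z₁ - z₀| < ε := by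
    by_contra! hcon
    obtain ⟨-, -, h⟩ := eq_zero_of_eventually_affine_add_zpow (A := -z₀ ^ E.n) (B := 0) (C := 1)
      (w₀ := z₀) E.n_ne_zero hn (by
        filter_upwards [Metric.ball_mem_nhds z₀ hε0] with w hw
        rw [Metric.mem_ball, Real.dist_eq] at hw
        by_contra hne
        exact absurd hw (not_lt.2 (hcon w fun h => hne (by rw [h]; ring))))
    exact one_ne_zero h
  set m := (partialX Φ (t₀, x₀, z₀)).2.1 with hm
  have hm0 : m ≠ 0 := H.partialX_space_ne_zero hp
  set Z := z₁ ^ E.n - z₀ ^ E.n with hZ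
  have hZ0 : Z ≠ 0 := sub_ne_zero.2 hz
  set G := (Φ (t₀, x₀, z₁)).2.2 ^ E'.n - (Φ (t₀, x₀, z₀)).2.2 ^ E'.n with hG
  have key : ∀ t, |t - t₀| < ε → ∃ S : ℝ, m ^ 5 * E.σ t = c * S ∧ m ^ 3 * E.β t = b * S ∧
      E.α t * m * Z = a * S * G := by
    intro t ht
    have hq : (t, x₀, z₀) ∈ Metric.ball ((t₀, x₀, z₀) : ℝ × ℝ × ℝ) ε :=
      mem_ball_triple.2 ⟨ht, by simpa using hε0, by simpa using hε0⟩
    have hq₁ : (t, x₀, z₁) ∈ Metric.ball ((t₀, x₀, z₀) : ℝ × ℝ × ℝ) ε :=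
      mem_ball_triple.2 ⟨ht, by simpa using hε0, hz₁⟩
    have h0₁ : (t₀, x₀, z₁) ∈ Metric.ball ((t₀, x₀, z₀) : ℝ × ℝ × ℝ) ε :=
      mem_ball_triple.2 ⟨by simpa using hε0, by simpa using hε0, hz₁⟩
    have r1 := H.pow_five_mul_σ (hε hq)
    have r2 := H.pow_three_mul_β (hε hq)
    have r3 := H.α_relation (hε hq)
    have r4 := H.α_relation (hε hq₁)
    rw [H.time_eq hε hq hq₁, H.partialT_time_eq hε hq hq₁, H.partialX_space_eq hε hq hq₁,
      H.partialT_space_eq hε hq hq₁, H.unknown_eq_of_ne_one hn hε h0₁ hq₁] at r4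
    rw [H.unknown_eq_of_ne_one hn hε h0 hq] at r3
    rw [H.slope_eq_of_ne_one hn hε0 hε ht, ← hm] at r1 r2 r3 r4
    obtain ⟨c1, c2, c3⟩ := hc' _ (hε hq)
    rw [c1] at r3 r4
    rw [c2] at r2
    rw [c3] at r1
    refine ⟨(partialT Φ (t, x₀, z₀)).1, r1, r2, ?_⟩
    rw [hZ, hG]
    linear_combination r3 - r4
  obtain ⟨S₀, s1, s2, s3⟩ := key t₀ (by simpa using hε0)
  filter_upwards [Metric.ball_mem_nhds t₀ hε0, E.isOpen_I.mem_nhds ht₀] with t ht htI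
  obtain ⟨S, r1, r2, r3⟩ := key t (by simpa [Real.dist_eq] using ht)
  have hα := E.α_ne_zero t htI
  have hα₀ := E.α_ne_zero t₀ ht₀
  constructor
  · rw [div_eq_div_iff hα hα₀]
    refine mul_left_cancel₀ (mul_ne_zero (pow_ne_zero 4 hm0) hZ0) ?_
    linear_combination E.α t₀ * m * Z * r2 - E.α t * m * Z * s2 + b * S * s3 - b * S₀ * r3
  · rw [div_eq_div_iff hα hα₀]
    refine mul_left_cancel₀ (mul_ne_zero (pow_ne_zero 6 hm0) hZ0) ?_
    linear_combination E.α t₀ * m * Z * r1 - E.α t * m * Z * s1 + c * S * s3 - c * S₀ * r3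

section quadratic

/-- If the nonlinearity of the first equation is quadratic, so is that of the second. -/
theorem exponent_eq_one (H : E.IsMappedBy E' Φ Ω) (hn : E.n = 1) {t x z : ℝ}
    (hp : (t, x, z) ∈ Ω) : E'.n = 1 := by
  by_contra hn'
  obtain ⟨ε, hε0, hε⟩ := H.exists_ball hp
  have h0 := Metric.mem_ball_self (x := (t, x, z)) hε0
  set K := (partialU Φ (t, x, z)).2.2 with hK
  have hK0 : K ≠ 0 := H.partialU_unknown_ne_zero hp
  set V := (Φ (t, x, z)).2.2 with hV
  have hlim : Tendsto (fun w => z + (w - V) / K) (𝓝 V) (𝓝 z) :=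
    (by fun_prop : Continuous fun w : ℝ => z + (w - V) / K).tendsto' V z (by simp)
  obtain ⟨-, -, h⟩ := eq_zero_of_eventually_affine_add_zpow (w₀ := V)
    (A := E.α t * (partialX Φ (t, x, z)).2.1 * (z - V / K) + (partialT Φ (t, x, z)).2.1)
    (B := E.α t * (partialX Φ (t, x, z)).2.1 / K)
    (C := -(E'.α (Φ (t, x, z)).1 * (partialT Φ (t, x, z)).1)) E'.n_ne_zero hn' (by
      filter_upwards [hlim.eventually (eventually_prodMk_unknown_mem Metric.isOpen_ball h0)]
        with w hw
      have r := H.α_relation (hε hw)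
      rw [H.time_eq hε h0 hw, H.partialT_time_eq hε h0 hw, H.partialX_space_eq hε h0 hw,
        H.partialT_space_eq hε h0 hw, H.unknown_eq hε h0 h0 hw, ← hK, ← hV, hn, zpow_one] at r
      have e : V + K * (z + (w - V) / K - z) = w := by field_simp; ring
      rw [e] at r
      have e2 : E.α t * (partialX Φ (t, x, z)).2.1 * (z + (w - V) / K)
        = E.α t * (partialX Φ (t, x, z)).2.1 * (z - V / K)
          + E.α t * (partialX Φ (t, x, z)).2.1 / K * w := by field_simp; ring
      linarith)
  exact mul_ne_zero (E'.α_ne_zero _ (H.mapsTo_domain hp).1) (H.partialT_time_ne_zero hp)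
    (neg_eq_zero.1 h)

theorem α_relation_of_eq_one (H : E.IsMappedBy E' Φ Ω) (hn : E.n = 1) {t x z : ℝ}
    (hp : (t, x, z) ∈ Ω) :
    E'.α (Φ (t, x, z)).1 * (partialT Φ (t, x, z)).1 * (Φ (t, x, z)).2.2
      = E.α t * (partialX Φ (t, x, z)).2.1 * z + (partialT Φ (t, x, z)).2.1 := by
  simpa [hn, H.exponent_eq_one hn hp] using H.α_relation hp

theorem factor_relation (H : E.IsMappedBy E' Φ Ω) (hn : E.n = 1) {t x z : ℝ}
    (hp : (t, x, z) ∈ Ω) :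
    E'.α (Φ (t, x, z)).1 * (partialT Φ (t, x, z)).1 * (partialU Φ (t, x, z)).2.2
      = E.α t * (partialX Φ (t, x, z)).2.1 := by
  obtain ⟨ε, hε0, hε⟩ := H.exists_ball hp
  have h0 := Metric.mem_ball_self (x := (t, x, z)) hε0
  have h1 : ∀ᶠ w in 𝓝[≠] z, (t, x, w) ∈ Metric.ball ((t, x, z) : ℝ × ℝ × ℝ) ε :=
    (eventually_prodMk_unknown_mem Metric.isOpen_ball h0).filter_mono nhdsWithin_le_nhds
  obtain ⟨w, hw, hwB⟩ := ((eventually_mem_nhdsWithin).and h1).exists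
  have r₀ := H.α_relation_of_eq_one hn hp
  have r := H.α_relation_of_eq_one hn (hε hwB)
  rw [H.time_eq hε h0 hwB, H.partialT_time_eq hε h0 hwB, H.partialX_space_eq hε h0 hwB,
    H.partialT_space_eq hε h0 hwB, H.unknown_eq hε h0 h0 hwB] at r
  refine mul_right_cancel₀ (sub_ne_zero.2 hw : w - z ≠ 0) ?_
  linear_combination r - r₀

theorem unknown_affine_space (H : E.IsMappedBy E' Φ Ω) (hn : E.n = 1) {p : ℝ × ℝ × ℝ} {ε : ℝ}
    (hε : Metric.ball p ε ⊆ Ω) {t x x' z : ℝ} (hq : (t, x, z) ∈ Metric.ball p ε)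
    (hq' : (t, x', z) ∈ Metric.ball p ε) :
    (Φ (t, x', z)).2.2 = (Φ (t, x, z)).2.2 + deriv (fun τ => (partialX Φ (τ, x, z)).2.1) t
      / (E'.α (Φ (t, x, z)).1 * (partialT Φ (t, x, z)).1) * (x' - x) := by
  have r₀ := H.α_relation_of_eq_one hn (hε hq)
  have r := H.α_relation_of_eq_one hn (hε hq')
  rw [H.time_eq hε hq hq', H.partialT_time_eq hε hq hq', H.partialX_space_eq hε hq hq',
    H.partialT_space_eq hε hq hq'] at r
  have h1 := E'.α_ne_zero _ (H.mapsTo_domain (hε hq)).1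
  have h2 := H.partialT_time_ne_zero (hε hq)
  refine mul_left_cancel₀ (mul_ne_zero h1 h2) ?_
  rw [mul_add, r₀, r]
  field_simp
  ring

theorem partialX_unknown_eq_div (H : E.IsMappedBy E' Φ Ω) (hn : E.n = 1) {t x z : ℝ}
    (hp : (t, x, z) ∈ Ω) :
    (partialX Φ (t, x, z)).2.2 = deriv (fun τ => (partialX Φ (τ, x, z)).2.1) t
      / (E'.α (Φ (t, x, z)).1 * (partialT Φ (t, x, z)).1) := by
  obtain ⟨ε, hε0, hε⟩ := H.exists_ball hp
  have h0 := Metric.mem_ball_self (x := (t, x, z)) hε0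
  have h1 : HasDerivAt (fun y => (Φ (t, x, z)).2.2
      + deriv (fun τ => (partialX Φ (τ, x, z)).2.1) t
        / (E'.α (Φ (t, x, z)).1 * (partialT Φ (t, x, z)).1) * (y - x))
      (deriv (fun τ => (partialX Φ (τ, x, z)).2.1) t
        / (E'.α (Φ (t, x, z)).1 * (partialT Φ (t, x, z)).1) * 1) x :=
    (((hasDerivAt_id x).sub_const x).const_mul _).const_add _
  rw [mul_one] at h1
  refine (H.hasDerivAt_unknown_space hp).unique (h1.congr_of_eventuallyEq ?_)
  filter_upwards [eventually_prodMk_space_mem Metric.isOpen_ball h0] with y hy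
  exact H.unknown_affine_space hn hε h0 hy

theorem unknown_affine_space' (H : E.IsMappedBy E' Φ Ω) (hn : E.n = 1) {p : ℝ × ℝ × ℝ} {ε : ℝ}
    (hε : Metric.ball p ε ⊆ Ω) {t x x' z : ℝ} (hq : (t, x, z) ∈ Metric.ball p ε)
    (hq' : (t, x', z) ∈ Metric.ball p ε) :
    (Φ (t, x', z)).2.2 = (Φ (t, x, z)).2.2 + (partialX Φ (t, x, z)).2.2 * (x' - x) := by
  rw [H.partialX_unknown_eq_div hn (hε hq)]
  exact H.unknown_affine_space hn hε hq hq'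

theorem eventually_source_of_eq_one (H : E.IsMappedBy E' Φ Ω) (hn : E.n = 1) {t x z : ℝ}
    (hp : (t, x, z) ∈ Ω) :
    ∀ᶠ w in 𝓝 z, (partialT Φ (t, x, z)).2.2
      + deriv (fun τ => (partialU Φ (τ, x, z)).2.2) t * (w - z)
      + E.α t * w * (partialX Φ (t, x, z)).2.2 = 0 := by
  obtain ⟨ε, hε0, hε⟩ := H.exists_ball hp
  have h0 := Metric.mem_ball_self (x := (t, x, z)) hε0
  have hf : (fun y => (Φ (t, y, z)).2.2) =ᶠ[𝓝 x]
      fun y => jetFunction t x (Φ (t, x, z)).2.2 0 (partialX Φ (t, x, z)).2.2 0 0 0 0 t y := by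
    filter_upwards [eventually_prodMk_space_mem Metric.isOpen_ball h0] with y hy
    rw [H.unknown_affine_space' hn hε h0 hy]
    simp [jetFunction]
  filter_upwards [H.eventually_source hp] with w hw
  rw [hf.iteratedDeriv_eq, hf.iteratedDeriv_eq, iteratedDeriv_three_jetFunction,
    iteratedDeriv_five_jetFunction, hn, zpow_one] at hw
  simpa using hw

theorem partialT_unknown_of_eq_one (H : E.IsMappedBy E' Φ Ω) (hn : E.n = 1) {t x z : ℝ}
    (hp : (t, x, z) ∈ Ω) :
    (partialT Φ (t, x, z)).2.2 = -(E.α t * z * (partialX Φ (t, x, z)).2.2) := by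
  have := (H.eventually_source_of_eq_one hn hp).self_of_nhds
  simp at this
  linarith

theorem deriv_factor (H : E.IsMappedBy E' Φ Ω) (hn : E.n = 1) {t x z : ℝ}
    (hp : (t, x, z) ∈ Ω) :
    deriv (fun τ => (partialU Φ (τ, x, z)).2.2) t = -(E.α t * (partialX Φ (t, x, z)).2.2) := by
  have h := H.eventually_source_of_eq_one hn hp
  have h1 := h.self_of_nhds
  obtain ⟨w, hw, hwz⟩ :=
    ((h.filter_mono (nhdsWithin_le_nhds (s := {z}ᶜ))).and eventually_mem_nhdsWithin).exists
  have h2 : (deriv (fun τ => (partialU Φ (τ, x, z)).2.2) t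
      + E.α t * (partialX Φ (t, x, z)).2.2) * (w - z) = 0 := by linear_combination hw - h1
  have := (mul_eq_zero.1 h2).resolve_right (sub_ne_zero.2 hwz)
  linarith

theorem partialX_unknown_const (H : E.IsMappedBy E' Φ Ω) (hn : E.n = 1) {t₀ x₀ z₀ ε : ℝ}
    (hε0 : 0 < ε) (hε : Metric.ball (t₀, x₀, z₀) ε ⊆ Ω) {t : ℝ} (ht : |t - t₀| < ε) :
    (partialX Φ (t, x₀, z₀)).2.2 = (partialX Φ (t₀, x₀, z₀)).2.2 := by
  obtain ⟨x₁, hx₁, hq₁⟩ := exists_mem_ball_space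
    (Metric.mem_ball_self (x := ((t₀, x₀, z₀) : ℝ × ℝ × ℝ)) hε0)
  have hx : x₁ - x₀ ≠ 0 := sub_ne_zero.2 hx₁
  rw [mem_ball_triple] at hq₁
  have hq : ∀ s, |s - t₀| < ε → (s, x₀, z₀) ∈ Metric.ball ((t₀, x₀, z₀) : ℝ × ℝ × ℝ) ε :=
    fun s hs => mem_ball_triple.2 ⟨hs, by simpa using hε0, by simpa using hε0⟩
  have hq' : ∀ s, |s - t₀| < ε → (s, x₁, z₀) ∈ Metric.ball ((t₀, x₀, z₀) : ℝ × ℝ × ℝ) ε :=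
    fun s hs => mem_ball_triple.2 ⟨hs, hq₁.2⟩
  have heq : ∀ s, |s - t₀| < ε → (partialX Φ (s, x₀, z₀)).2.2 * (x₁ - x₀)
      = (Φ (s, x₁, z₀)).2.2 - (Φ (s, x₀, z₀)).2.2 := by
    intro s hs
    rw [H.unknown_affine_space' hn hε (hq s hs) (hq' s hs)]
    ring
  have hcst := eqOn_ball_of_hasDerivAt_zero
    (f := fun s => (Φ (s, x₁, z₀)).2.2 - (Φ (s, x₀, z₀)).2.2) (fun s hs => by
      have h := (H.hasDerivAt_unknown_time (hε (hq' s hs))).sub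
        (H.hasDerivAt_unknown_time (hε (hq s hs)))
      refine h.congr_deriv ?_
      have e1 := H.unknown_affine_space' hn hε (hq s hs) (hq' s hs)
      have e2 := H.unknown_affine_space' hn hε (hq' s hs) (hq s hs)
      have e3 : ((partialX Φ (s, x₀, z₀)).2.2 - (partialX Φ (s, x₁, z₀)).2.2) * (x₁ - x₀) = 0 := by
        linarith
      have e4 := sub_eq_zero.1 ((mul_eq_zero.1 e3).resolve_right hx)
      rw [H.partialT_unknown_of_eq_one hn (hε (hq s hs)),
        H.partialT_unknown_of_eq_one hn (hε (hq' s hs)), e4]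
      ring) ht
  rw [← heq t ht, ← heq t₀ (by simpa using hε0)] at hcst
  exact mul_right_cancel₀ hx hcst

theorem invariants_of_eq_one (H : E.IsMappedBy E' Φ Ω) (hn : E.n = 1) {a b c : ℝ}
    (hc : ∀ t ∈ E'.I, E'.α t = a ∧ E'.β t = b ∧ E'.σ t = c) {t₀ : ℝ} (ht₀ : t₀ ∈ E.I) :
    ∃ k l : ℝ, ∀ᶠ t in 𝓝 t₀, deriv (fun r => E.β r / E.α r) t / E.α t = k ∧
      E.σ t * E.α t ^ 2 / E.β t ^ 3 = l := by
  obtain ⟨x₀, z₀, hp⟩ := H.covers_time t₀ ht₀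
  obtain ⟨ε, hε0, hε⟩ := H.exists_ball hp
  have hq : ∀ s, |s - t₀| < ε → (s, x₀, z₀) ∈ Metric.ball ((t₀, x₀, z₀) : ℝ × ℝ × ℝ) ε :=
    fun s hs => mem_ball_triple.2 ⟨hs, by simpa using hε0, by simpa using hε0⟩
  set m : ℝ → ℝ := fun t => (partialX Φ (t, x₀, z₀)).2.1 with hm
  set K : ℝ → ℝ := fun t => (partialU Φ (t, x₀, z₀)).2.2 with hK
  set S : ℝ → ℝ := fun t => (partialT Φ (t, x₀, z₀)).1 with hS
  set P := (partialX Φ (t₀, x₀, z₀)).2.2 with hP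
  obtain ⟨ha, hb⟩ : a ≠ 0 ∧ b ≠ 0 := by
    have hI := (H.mapsTo_domain hp).1
    obtain ⟨c1, c2, -⟩ := hc _ hI
    exact ⟨c1 ▸ E'.α_ne_zero _ hI, c2 ▸ E'.β_ne_zero _ hI⟩
  have key : ∀ t, |t - t₀| < ε → m t ^ 5 * E.σ t = c * S t ∧ m t ^ 3 * E.β t = b * S t ∧
      a * S t * K t = E.α t * m t ∧ HasDerivAt m (a * S t * P) t ∧
      HasDerivAt K (-(E.α t * P)) t ∧ m t ≠ 0 ∧ K t ≠ 0 ∧ S t ≠ 0 := by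
    intro t ht
    have hqΩ := hε (hq t ht)
    obtain ⟨c1, c2, c3⟩ := hc _ (H.mapsTo_domain hqΩ).1
    have hS0 := H.partialT_time_ne_zero hqΩ
    have hPt := H.partialX_unknown_const hn hε0 hε ht
    have r1 := H.pow_five_mul_σ hqΩ
    have r2 := H.pow_three_mul_β hqΩ
    have r3 := H.factor_relation hn hqΩ
    have r4 := H.hasDerivAt_slope hqΩ
    have r5 := H.hasDerivAt_factor hqΩ
    have r6 := H.partialX_unknown_eq_div hn hqΩ
    rw [H.deriv_factor hn hqΩ, hPt] at r5
    rw [c3] at r1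
    rw [c2] at r2
    rw [c1] at r3
    rw [hPt, c1, eq_div_iff (mul_ne_zero ha hS0)] at r6
    rw [← r6] at r4
    exact ⟨r1, r2, r3, r4.congr_deriv (mul_comm _ _), r5, H.partialX_space_ne_zero hqΩ,
      H.partialU_unknown_ne_zero hqΩ, hS0⟩
  have hC : ∀ t, |t - t₀| < ε → K t * m t = K t₀ * m t₀ := by
    intro t ht
    refine eqOn_ball_of_hasDerivAt_zero (f := fun s => K s * m s) (fun s hs => ?_) ht
    obtain ⟨-, -, r3, r4, r5, -⟩ := key s hs
    refine (r5.mul r4).congr_deriv ?_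
    linear_combination P * r3
  set C := K t₀ * m t₀ with hCdef
  have hC0 : C ≠ 0 := by
    obtain ⟨-, -, -, -, -, h1, h2, -⟩ := key t₀ (by simpa using hε0)
    exact mul_ne_zero h2 h1
  have hratio : ∀ t, |t - t₀| < ε → E.β t / E.α t = b / (a * C) * (m t)⁻¹ := by
    intro t ht
    obtain ⟨-, r2, r3, -, -, m0, K0, S0⟩ := key t ht
    have hα : E.α t ≠ 0 := H.α_ne_zero (hε (hq t ht))
    rw [← hC t ht]
    field_simp
    refine mul_left_cancel₀ (mul_ne_zero m0 S0) ?_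
    linear_combination K t * S t * a * r2 + b * S t * r3
  have hball : ∀ᶠ t in 𝓝 t₀, |t - t₀| < ε := by
    filter_upwards [Metric.ball_mem_nhds t₀ hε0] with t ht
    simpa [Real.dist_eq] using ht
  refine ⟨-(b * P) / (a * C ^ 2), c * a ^ 2 * C ^ 2 / b ^ 3, ?_⟩
  filter_upwards [hball.eventually_nhds] with t ht
  have ht' := ht.self_of_nhds
  obtain ⟨r1, r2, r3, r4, r5, m0, K0, S0⟩ := key t ht'
  have hα : E.α t ≠ 0 := H.α_ne_zero (hε (hq t ht'))
  have hβ : E.β t ≠ 0 := E.β_ne_zero _ (H.subset_domain (hε (hq t ht'))).1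
  constructor
  · have e : (fun r => E.β r / E.α r) =ᶠ[𝓝 t] fun r => b / (a * C) * (m r)⁻¹ := by
      filter_upwards [ht] with r hr using hratio r hr
    have d : HasDerivAt (fun r => b / (a * C) * (m r)⁻¹)
        (b / (a * C) * (-(a * S t * P) / m t ^ 2)) t := (r4.inv m0).const_mul (b / (a * C))
    rw [e.deriv_eq, d.deriv, ← hC t ht']
    field_simp
    linear_combination -P * r3
  · have e1 : E.σ t = c * S t / m t ^ 5 := by rw [eq_div_iff (pow_ne_zero 5 m0)]; linarith
    have e2 : E.β t = b * S t / m t ^ 3 := by rw [eq_div_iff (pow_ne_zero 3 m0)]; linarith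
    have e3 : E.α t = a * S t * K t / m t := by rw [eq_div_iff m0]; linarith
    rw [e1, e2, e3, ← hC t ht']
    field_simp

end quadratic

end KawaharaEq.IsMappedBy

namespace KawaharaEq.ReducibleToConstantCoefficients

variable {E : KawaharaEq}

theorem deriv_ratios_eq_zero (h : E.ReducibleToConstantCoefficients) (hn : E.n ≠ 1) {t : ℝ}
    (ht : t ∈ E.I) :
    deriv (fun s => E.β s / E.α s) t = 0 ∧ deriv (fun s => E.σ s / E.α s) t = 0 := by
  obtain ⟨E', ⟨a, b, c, hc⟩, Φ, Ω, H⟩ := h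
  have key := H.ratios_eq_of_ne_one hn hc ht
  have h1 : (fun s => E.β s / E.α s) =ᶠ[𝓝 t] fun _ => E.β t / E.α t := key.mono fun _ h => h.1
  have h2 : (fun s => E.σ s / E.α s) =ᶠ[𝓝 t] fun _ => E.σ t / E.α t := key.mono fun _ h => h.2
  exact ⟨by rw [h1.deriv_eq, deriv_const], by rw [h2.deriv_eq, deriv_const]⟩

theorem deriv_invariants_eq_zero (h : E.ReducibleToConstantCoefficients) (hn : E.n = 1) {t : ℝ}
    (ht : t ∈ E.I) :
    deriv (fun s => deriv (fun r => E.β r / E.α r) s / E.α s) t = 0 ∧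
      deriv (fun s => E.σ s * E.α s ^ 2 / E.β s ^ 3) t = 0 := by
  obtain ⟨E', ⟨a, b, c, hc⟩, Φ, Ω, H⟩ := h
  obtain ⟨k, l, key⟩ := H.invariants_of_eq_one hn hc ht
  have h1 : (fun s => deriv (fun r => E.β r / E.α r) s / E.α s) =ᶠ[𝓝 t] fun _ => k :=
    key.mono fun _ h => h.1
  have h2 : (fun s => E.σ s * E.α s ^ 2 / E.β s ^ 3) =ᶠ[𝓝 t] fun _ => l :=
    key.mono fun _ h => h.2
  exact ⟨by rw [h1.deriv_eq, deriv_const], by rw [h2.deriv_eq, deriv_const]⟩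

end KawaharaEq.ReducibleToConstantCoefficients

theorem KawaharaEq.isOpen_domain (E : KawaharaEq) : IsOpen E.domain := by
  by_cases hn : E.n < 0
  · have : E.domain = Prod.fst ⁻¹' E.I ∩ {p : ℝ × ℝ × ℝ | p.2.2 ≠ 0} := by
      ext p; simp [KawaharaEq.domain, hn]
    rw [this]
    exact (E.isOpen_I.preimage continuous_fst).inter
      (isOpen_ne_fun (by fun_prop) continuous_const)
  · have : E.domain = Prod.fst ⁻¹' E.I := by
      ext p; simp [KawaharaEq.domain, hn]
    rw [this]
    exact E.isOpen_I.preimage continuous_fst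

/-- The transformation `t' = T(t)`, `x' = m(t) x`, `u' = K(t) u + k x`. -/
def dilation (T m K : ℝ → ℝ) (k : ℝ) (p : ℝ × ℝ × ℝ) : ℝ × ℝ × ℝ :=
  (T p.1, m p.1 * p.2.1, K p.1 * p.2.2 + k * p.2.1)

section dilation

variable {T m K S m' K' : ℝ → ℝ} {k : ℝ} {I : Set ℝ}

theorem contDiffAt_dilation (hI : IsOpen I) (hT : ContDiffOn ℝ ∞ T I) (hm : ContDiffOn ℝ ∞ m I)
    (hK : ContDiffOn ℝ ∞ K I) {p : ℝ × ℝ × ℝ} (hp : p.1 ∈ I) :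
    ContDiffAt ℝ ∞ (dilation T m K k) p := by
  have key : ∀ f : ℝ → ℝ, ContDiffOn ℝ ∞ f I → ContDiffAt ℝ ∞ (fun q : ℝ × ℝ × ℝ => f q.1) p :=
    fun f hf => ContDiffAt.comp p (hf.contDiffAt (hI.mem_nhds hp)) contDiffAt_fst
  have hx : ContDiffAt ℝ ∞ (fun q : ℝ × ℝ × ℝ => q.2.1) p := by fun_prop
  have hu : ContDiffAt ℝ ∞ (fun q : ℝ × ℝ × ℝ => q.2.2) p := by fun_prop
  exact (key T hT).prodMk (((key m hm).mul hx).prodMk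
    (((key K hK).mul hu).add (contDiffAt_const.mul hx)))

theorem partials_dilation {t x z : ℝ} (hd : DifferentiableAt ℝ (dilation T m K k) (t, x, z))
    (hT : HasDerivAt T (S t) t) (hm : HasDerivAt m (m' t) t) (hK : HasDerivAt K (K' t) t) :
    partialT (dilation T m K k) (t, x, z) = (S t, m' t * x, K' t * z) ∧
    partialX (dilation T m K k) (t, x, z) = (0, m t, k) ∧
    partialU (dilation T m K k) (t, x, z) = (0, 0, K t) := by
  refine ⟨?_, ?_, ?_⟩
  · have h1 := HasFDerivAt.comp_hasDerivAt (l := dilation T m K k) t hd.hasFDerivAt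
      ((hasDerivAt_id t).prodMk (hasDerivAt_const t (x, z)))
    refine h1.unique ?_
    exact hT.prodMk ((hm.mul_const x).prodMk ((hK.mul_const z).add_const (k * x)))
  · have h1 := HasFDerivAt.comp_hasDerivAt (l := dilation T m K k) x hd.hasFDerivAt
      ((hasDerivAt_const x t).prodMk ((hasDerivAt_id x).prodMk (hasDerivAt_const x z)))
    refine h1.unique ?_
    have h2 := (hasDerivAt_const x (T t)).prodMk (((hasDerivAt_id x).const_mul (m t)).prodMk
      (((hasDerivAt_id x).const_mul k).const_add (K t * z)))
    rw [mul_one, mul_one] at h2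
    exact h2
  · have h1 := HasFDerivAt.comp_hasDerivAt (l := dilation T m K k) z hd.hasFDerivAt
      ((hasDerivAt_const z t).prodMk ((hasDerivAt_const z x).prodMk (hasDerivAt_id z)))
    refine h1.unique ?_
    have h2 := (hasDerivAt_const z (T t)).prodMk ((hasDerivAt_const z (m t * x)).prodMk
      (((hasDerivAt_id z).const_mul (K t)).add_const (k * x)))
    rw [mul_one] at h2
    exact h2

theorem isPointTransformation_dilation {Ω : Set (ℝ × ℝ × ℝ)} (hΩ : IsOpen Ω) (hI : IsOpen I)
    (hΩI : ∀ p ∈ Ω, p.1 ∈ I) (hT : ContDiffOn ℝ ∞ T I) (hm : ContDiffOn ℝ ∞ m I)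
    (hK : ContDiffOn ℝ ∞ K I) (hTi : Set.InjOn T I) (hTd : ∀ t ∈ I, HasDerivAt T (S t) t)
    (hmd : ∀ t ∈ I, HasDerivAt m (m' t) t) (hKd : ∀ t ∈ I, HasDerivAt K (K' t) t)
    (hS0 : ∀ t ∈ I, S t ≠ 0) (hm0 : ∀ t ∈ I, m t ≠ 0) (hK0 : ∀ t ∈ I, K t ≠ 0) :
    IsPointTransformation (dilation T m K k) Ω where
  isOpen := hΩ
  smooth := fun p hp => (contDiffAt_dilation hI hT hm hK (hΩI p hp)).contDiffWithinAt
  injOn := by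
    rintro ⟨t, x, z⟩ hp ⟨t', x', z'⟩ hp' h
    simp only [dilation, Prod.mk.injEq] at h
    obtain ⟨h1, h2, h3⟩ := h
    obtain rfl : t = t' := hTi (hΩI _ hp) (hΩI _ hp') h1
    obtain rfl : x = x' := mul_left_cancel₀ (hm0 t (hΩI _ hp)) h2
    obtain rfl : z = z' := mul_left_cancel₀ (hK0 t (hΩI _ hp)) (add_right_cancel h3)
    rfl
  jacobian_ne_zero := by
    rintro ⟨t, x, z⟩ hp
    have ht : t ∈ I := hΩI _ hp
    obtain ⟨p1, p2, p3⟩ := partials_dilation (x := x) (z := z) (k := k)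
      ((contDiffAt_dilation (p := (t, x, z)) hI hT hm hK ht).differentiableAt (by simp))
      (hTd t ht) (hmd t ht) (hKd t ht)
    have hker : LinearMap.ker
        ((fderiv ℝ (dilation T m K k) (t, x, z)) : (ℝ × ℝ × ℝ) →ₗ[ℝ] (ℝ × ℝ × ℝ)) = ⊥ := by
      rw [LinearMap.ker_eq_bot']
      rintro ⟨r, s, w⟩ h
      have h' : fderiv ℝ (dilation T m K k) (t, x, z) (r, s, w) = 0 := h
      rw [fderiv_apply_eq_partials, p1, p2, p3] at h'
      have e1 := congrArg Prod.fst h'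
      have e2 := congrArg (fun q => q.2.1) h'
      have e3 := congrArg (fun q => q.2.2) h'
      simp [hS0 t ht] at e1
      simp [e1, hm0 t ht] at e2
      simp [e1, e2, hK0 t ht] at e3
      simp [e1, e2, e3]
    exact (LinearMap.isUnit_det _ (LinearMap.isUnit_iff_ker_eq_bot _ |>.2 hker)).ne_zero

theorem KawaharaEq.isMappedBy_dilation {E E' : KawaharaEq} (hI' : E'.I = Set.univ)
    (hT : ContDiffOn ℝ ∞ T E.I) (hm : ContDiffOn ℝ ∞ m E.I)
    (hK : ContDiffOn ℝ ∞ K E.I) (hTi : Set.InjOn T E.I) (hTd : ∀ t ∈ E.I, HasDerivAt T (S t) t)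
    (hmd : ∀ t ∈ E.I, HasDerivAt m (m' t) t) (hKd : ∀ t ∈ E.I, HasDerivAt K (K' t) t)
    (hS0 : ∀ t ∈ E.I, S t ≠ 0) (hm0 : ∀ t ∈ E.I, m t ≠ 0) (hK0 : ∀ t ∈ E.I, K t ≠ 0)
    (hdom : ∀ t x z : ℝ, (t, x, z) ∈ E.domain → E'.n < 0 → K t * z + k * x ≠ 0)
    (hσ : ∀ t ∈ E.I, m t ^ 5 * E.σ t = E'.σ (T t) * S t)
    (hβ : ∀ t ∈ E.I, m t ^ 3 * E.β t = E'.β (T t) * S t)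
    (hα : ∀ t x z : ℝ, (t, x, z) ∈ E.domain →
      E'.α (T t) * S t * (K t * z + k * x) ^ E'.n = E.α t * m t * z ^ E.n + m' t * x)
    (hsource : ∀ t x z : ℝ, (t, x, z) ∈ E.domain → K' t * z + E.α t * z ^ E.n * k = 0) :
    E.IsMappedBy E' (dilation T m K k) E.domain where
  isPointTransformation := isPointTransformation_dilation E.isOpen_domain E.isOpen_I
    (fun p hp => hp.1) hT hm hK hTi hTd hmd hKd hS0 hm0 hK0
  subset_domain := subset_rfl
  mapsTo_domain := by
    rintro ⟨t, x, z⟩ hp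
    exact ⟨by rw [hI']; trivial, hdom t x z hp⟩
  covers_time := fun t ht => ⟨0, 1, ht, fun _ => one_ne_zero⟩
  holdsAt_iff := by
    intro u v t x hp hu hv h
    have ht : t ∈ E.I := hp.1
    have hd : DifferentiableAt ℝ (dilation T m K k) (t, x, u t x) :=
      (contDiffAt_dilation E.isOpen_I hT hm hK ht).differentiableAt (by simp)
    obtain ⟨p1, p2, p3⟩ := partials_dilation (x := x) (z := u t x) hd
      (hTd t ht) (hmd t ht) (hKd t ht)
    have hu' := (hu.differentiableAt (by simp)).hasFDerivAt
    rw [hu'.eq_fst_snd] at hu'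
    obtain ⟨A, B⟩ := h.first_order rfl hd hu' hv
    rw [p1, p3] at A
    rw [p2, p3] at B
    have h0 := h.self_of_nhds
    have hc : Tendsto (fun y : ℝ => ((t, y) : ℝ × ℝ)) (𝓝 x) (𝓝 (t, x)) :=
      (by fun_prop : Continuous fun y : ℝ => ((t, y) : ℝ × ℝ)).tendsto x
    have hev : ∀ᶠ y in 𝓝 x, v (T t) (m t * y + 0) = K t * u t y + k * y := by
      filter_upwards [hc.eventually h] with y hy
      rw [add_zero]
      exact hy
    simp only [dilation] at A B h0 ⊢
    have hle : ∀ j : ℕ, (j : ℕ∞ω) ≤ ∞ := fun j => by exact_mod_cast le_top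
    have hk : ∀ j : ℕ, m t ^ (j + 2) * iteratedDeriv (j + 2) (fun y => v (T t) y) (m t * x)
        = K t * iteratedDeriv (j + 2) (fun y => u t y) x := by
      intro j
      have h1 := iteratedDeriv_of_eventuallyEq_comp_affine (g := fun y => v (T t) y) hev (j + 2)
      have h2 : deriv (fun y : ℝ => k * y) = fun _ => k := by
        funext y; simp
      have huC : ContDiffAt ℝ ((j + 2 : ℕ) : ℕ∞ω) (fun y => u t y) x := hu.slice.of_le (hle _)
      rw [add_zero] at h1
      rw [h1, iteratedDeriv_fun_add (contDiffAt_const.mul huC) (by fun_prop),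
        iteratedDeriv_const_mul_field, iteratedDeriv_succ' (f := fun y : ℝ => k * y), h2,
        iteratedDeriv_const, if_neg (by omega), add_zero]
    have k3 := hk 1
    have k5 := hk 3
    norm_num at k3 k5
    simp at A B
    unfold KawaharaEq.HoldsAt
    rw [h0]
    have e : S t * (deriv (fun s => v s (m t * x)) (T t)
        + E'.α (T t) * (K t * u t x + k * x) ^ E'.n * deriv (fun y => v (T t) y) (m t * x)
        + E'.β (T t) * iteratedDeriv 3 (fun y => v (T t) y) (m t * x)
        + E'.σ (T t) * iteratedDeriv 5 (fun y => v (T t) y) (m t * x))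
      = K t * (deriv (fun s => u s x) t + E.α t * u t x ^ E.n * deriv (fun y => u t y) x
        + E.β t * iteratedDeriv 3 (fun y => u t y) x
        + E.σ t * iteratedDeriv 5 (fun y => u t y) x) := by
      linear_combination A + E.α t * u t x ^ E.n * B + hsource t x (u t x) hp
        + deriv (fun y => v (T t) y) (m t * x) * hα t x (u t x) hp
        - iteratedDeriv 3 (fun y => v (T t) y) (m t * x) * hβ t ht
        - iteratedDeriv 5 (fun y => v (T t) y) (m t * x) * hσ t ht
        + E.β t * k3 + E.σ t * k5
    constructor
    · intro h1
      rw [h1, mul_zero] at e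
      exact (mul_eq_zero.1 e).resolve_left (hS0 t ht)
    · intro h1
      rw [h1, mul_zero] at e
      exact (mul_eq_zero.1 e.symm).resolve_left (hK0 t ht)

end dilation

/-- A smooth nowhere vanishing function on an open interval has a smooth injective primitive. -/
theorem exists_injective_primitive {I : Set ℝ} (hI : IsOpen I) (hI' : I.OrdConnected) {S : ℝ → ℝ}
    (hS : ContDiffOn ℝ ∞ S I) (hS0 : ∀ t ∈ I, S t ≠ 0) :
    ∃ T : ℝ → ℝ, ContDiffOn ℝ ∞ T I ∧ Set.InjOn T I ∧ ∀ t ∈ I, HasDerivAt T (S t) t := by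
  rcases I.eq_empty_or_nonempty with rfl | ⟨t₀, ht₀⟩
  · exact ⟨id, by simp, by simp, by simp⟩
  have hd : ∀ t ∈ I, HasDerivAt (fun t => ∫ s in t₀..t, S s) (S t) t := by
    intro t ht
    have hsub : Set.uIcc t₀ t ⊆ I := hI'.uIcc_subset ht₀ ht
    exact intervalIntegral.integral_hasDerivAt_right
      (hS.continuousOn.mono hsub).intervalIntegrable
      (hS.continuousOn.stronglyMeasurableAtFilter hI t ht)
      (hS.continuousOn.continuousAt (hI.mem_nhds ht))
  refine ⟨fun t => ∫ s in t₀..t, S s, ?_, ?_, hd⟩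
  · rw [contDiffOn_infty_iff_deriv_of_isOpen hI]
    exact ⟨fun t ht => (hd t ht).differentiableAt.differentiableWithinAt,
      hS.congr fun t ht => (hd t ht).deriv⟩
  · have key : ∀ a ∈ I, ∀ b ∈ I, a < b → (∫ s in t₀..a, S s) ≠ ∫ s in t₀..b, S s := by
      intro a ha b hb hab heq
      have hsub : Set.Icc a b ⊆ I := hI'.out ha hb
      obtain ⟨c, hc, hc0⟩ := exists_hasDerivAt_eq_zero hab
        (fun t ht => (hd t (hsub ht)).continuousAt.continuousWithinAt) heq
        (fun t ht => hd t (hsub (Set.Ioo_subset_Icc_self ht)))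
      exact hS0 c (hsub (Set.Ioo_subset_Icc_self hc)) hc0
    intro a ha b hb hab
    rcases lt_trichotomy a b with h | h | h
    · exact absurd hab (key a ha b hb h)
    · exact h
    · exact absurd hab.symm (key b hb a ha h)

namespace KawaharaEq

/-- An equation with constant coefficients for all times. -/
def const (n : ℤ) (a b c : ℝ) (hn : n ≠ 0) (ha : a ≠ 0) (hb : b ≠ 0) (hc : c ≠ 0) :
    KawaharaEq where
  n := n
  I := Set.univ
  α := fun _ => a
  β := fun _ => b
  σ := fun _ => c
  n_ne_zero := hn
  isOpen_I := isOpen_univ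
  ordConnected_I := Set.ordConnected_univ
  α_smooth := contDiffOn_const
  β_smooth := contDiffOn_const
  σ_smooth := contDiffOn_const
  α_ne_zero := fun _ _ => ha
  β_ne_zero := fun _ _ => hb
  σ_ne_zero := fun _ _ => hc

variable (E : KawaharaEq)

theorem reducible_of_isEmpty (h : E.I = ∅) : E.ReducibleToConstantCoefficients := by
  refine ⟨E, ⟨0, 0, 0, by simp [h]⟩, id, ∅, ⟨isOpen_empty, by simp, by simp, by simp⟩, by simp,
    by simp [Set.MapsTo], by simp [h], by simp⟩

theorem eq_of_deriv_eq_zero {f : ℝ → ℝ} (hf : ContDiffOn ℝ ∞ f E.I) (h : ∀ t ∈ E.I, deriv f t = 0)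
    {t t₀ : ℝ} (ht : t ∈ E.I) (ht₀ : t₀ ∈ E.I) : f t = f t₀ :=
  E.isOpen_I.is_const_of_deriv_eq_zero E.ordConnected_I.isPreconnected
    (hf.differentiableOn (by simp)) (fun s hs => h s hs) ht ht₀

theorem reducible_of_ratios
    (h : ∀ t ∈ E.I, deriv (fun s => E.β s / E.α s) t = 0 ∧ deriv (fun s => E.σ s / E.α s) t = 0) :
    E.ReducibleToConstantCoefficients := by
  rcases E.I.eq_empty_or_nonempty with h0 | ⟨t₀, ht₀⟩
  · exact E.reducible_of_isEmpty h0
  have hβ : ∀ t ∈ E.I, E.β t / E.α t = E.β t₀ / E.α t₀ := fun t ht =>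
    E.eq_of_deriv_eq_zero (f := fun s => E.β s / E.α s) (E.β_smooth.div E.α_smooth E.α_ne_zero)
    (fun s hs => (h s hs).1) ht ht₀
  have hσ : ∀ t ∈ E.I, E.σ t / E.α t = E.σ t₀ / E.α t₀ := fun t ht =>
    E.eq_of_deriv_eq_zero (f := fun s => E.σ s / E.α s) (E.σ_smooth.div E.α_smooth E.α_ne_zero)
    (fun s hs => (h s hs).2) ht ht₀
  obtain ⟨T, hT, hTi, hTd⟩ :=
    exists_injective_primitive E.isOpen_I E.ordConnected_I E.α_smooth E.α_ne_zero
  refine ⟨const E.n 1 (E.β t₀ / E.α t₀) (E.σ t₀ / E.α t₀) E.n_ne_zero one_ne_zero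
    (div_ne_zero (E.β_ne_zero _ ht₀) (E.α_ne_zero _ ht₀))
    (div_ne_zero (E.σ_ne_zero _ ht₀) (E.α_ne_zero _ ht₀)), ⟨_, _, _, fun _ _ => ⟨rfl, rfl, rfl⟩⟩,
    dilation T (fun _ => 1) (fun _ => 1) 0, E.domain,
    isMappedBy_dilation (S := E.α) (m' := fun _ => 0) (K' := fun _ => 0) rfl hT contDiffOn_const
      contDiffOn_const hTi hTd (fun t _ => hasDerivAt_const t 1) (fun t _ => hasDerivAt_const t 1)
      E.α_ne_zero (by simp) (by simp) ?_ ?_ ?_ ?_ ?_⟩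
  · intro t x z hp hn
    simpa using hp.2 hn
  · intro t ht
    have := hσ t ht
    have hα := E.α_ne_zero t ht
    simp only [const, ← this]
    field_simp
  · intro t ht
    have := hβ t ht
    have hα := E.α_ne_zero t ht
    simp only [const, ← this]
    field_simp
  · intro t x z _
    simp [const]
  · intro t x z _
    simp

theorem reducible_of_invariants (hn : E.n = 1)
    (h : ∀ t ∈ E.I, deriv (fun s => deriv (fun r => E.β r / E.α r) s / E.α s) t = 0 ∧
      deriv (fun s => E.σ s * E.α s ^ 2 / E.β s ^ 3) t = 0) :
    E.ReducibleToConstantCoefficients := by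
  rcases E.I.eq_empty_or_nonempty with h0 | ⟨t₀, ht₀⟩
  · exact E.reducible_of_isEmpty h0
  have hK : ContDiffOn ℝ ∞ (fun t => E.β t / E.α t) E.I :=
    E.β_smooth.div E.α_smooth E.α_ne_zero
  have hm : ContDiffOn ℝ ∞ (fun t => E.α t / E.β t) E.I :=
    E.α_smooth.div E.β_smooth E.β_ne_zero
  have hK' := ((contDiffOn_infty_iff_deriv_of_isOpen E.isOpen_I).1 hK).2
  have hKd : ∀ t ∈ E.I, HasDerivAt (fun t => E.β t / E.α t)
      (deriv (fun r => E.β r / E.α r) t) t := fun t ht =>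
    ((hK.contDiffAt (E.isOpen_I.mem_nhds ht)).differentiableAt (by simp)).hasDerivAt
  have hk : ∀ t ∈ E.I, deriv (fun r => E.β r / E.α r) t / E.α t
      = deriv (fun r => E.β r / E.α r) t₀ / E.α t₀ := fun t ht =>
    E.eq_of_deriv_eq_zero (f := fun s => deriv (fun r => E.β r / E.α r) s / E.α s) (hK'.div E.α_smooth E.α_ne_zero)
    (fun s hs => (h s hs).1) ht ht₀
  have hβ3 : ∀ t ∈ E.I, E.β t ^ 3 ≠ 0 := fun t ht => pow_ne_zero 3 (E.β_ne_zero t ht)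
  have hσ : ∀ t ∈ E.I, E.σ t * E.α t ^ 2 / E.β t ^ 3 = E.σ t₀ * E.α t₀ ^ 2 / E.β t₀ ^ 3 :=
    fun t ht => E.eq_of_deriv_eq_zero (f := fun s => E.σ s * E.α s ^ 2 / E.β s ^ 3)
    ((E.σ_smooth.mul (E.α_smooth.pow 2)).div (E.β_smooth.pow 3) hβ3) (fun s hs => (h s hs).2) ht ht₀
  set k := deriv (fun r => E.β r / E.α r) t₀ / E.α t₀
  have hkα : ∀ t ∈ E.I, deriv (fun r => E.β r / E.α r) t = k * E.α t := fun t ht => by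
    rw [← hk t ht]
    have := E.α_ne_zero t ht
    field_simp
  obtain ⟨T, hT, hTi, hTd⟩ :=
    exists_injective_primitive (S := fun t => E.α t ^ 3 / E.β t ^ 2) E.isOpen_I E.ordConnected_I
      ((E.α_smooth.pow 3).div (E.β_smooth.pow 2) fun t ht => pow_ne_zero 2 (E.β_ne_zero t ht))
      (fun t ht => div_ne_zero (pow_ne_zero 3 (E.α_ne_zero t ht))
        (pow_ne_zero 2 (E.β_ne_zero t ht)))
  refine ⟨const 1 1 1 (E.σ t₀ * E.α t₀ ^ 2 / E.β t₀ ^ 3) one_ne_zero one_ne_zero one_ne_zero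
    (div_ne_zero (mul_ne_zero (E.σ_ne_zero _ ht₀) (pow_ne_zero 2 (E.α_ne_zero _ ht₀)))
      (hβ3 _ ht₀)), ⟨_, _, _, fun _ _ => ⟨rfl, rfl, rfl⟩⟩,
    dilation T (fun t => E.α t / E.β t) (fun t => E.β t / E.α t) (-k), E.domain,
    isMappedBy_dilation (S := fun t => E.α t ^ 3 / E.β t ^ 2)
      (m' := fun t => -(k * E.α t) / (E.β t / E.α t) ^ 2) (K' := fun t => k * E.α t) rfl hT hm hK
      hTi hTd ?_ ?_
      (fun t ht => div_ne_zero (pow_ne_zero 3 (E.α_ne_zero t ht))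
        (pow_ne_zero 2 (E.β_ne_zero t ht)))
      (fun t ht => div_ne_zero (E.α_ne_zero t ht) (E.β_ne_zero t ht))
      (fun t ht => div_ne_zero (E.β_ne_zero t ht) (E.α_ne_zero t ht)) ?_ ?_ ?_ ?_ ?_⟩
  · intro t ht
    have hd := (hkα t ht ▸ hKd t ht).inv (div_ne_zero (E.β_ne_zero t ht) (E.α_ne_zero t ht))
    refine hd.congr_of_eventuallyEq (Eventually.of_forall fun s => ?_)
    simp
  · intro t ht
    exact hkα t ht ▸ hKd t ht
  · intro t x z _ h1
    simp [const] at h1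
  · intro t ht
    have hα := E.α_ne_zero t ht
    have hβ := E.β_ne_zero t ht
    simp only [const, ← hσ t ht]
    field_simp
  · intro t ht
    have hα := E.α_ne_zero t ht
    have hβ := E.β_ne_zero t ht
    simp only [const]
    field_simp
  · intro t x z hp
    have hα := E.α_ne_zero t hp.1
    have hβ := E.β_ne_zero t hp.1
    simp only [const, hn, zpow_one]
    field_simp
  · intro t x z hp
    rw [hn, zpow_one]
    ring

end KawaharaEq

theorem theorem3 (E : KawaharaEq) :
    (E.n ≠ 1 →
      (E.ReducibleToConstantCoefficients ↔
        ∀ t ∈ E.I,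
          deriv (fun s => E.β s / E.α s) t = 0 ∧
          deriv (fun s => E.σ s / E.α s) t = 0)) ∧
    (E.n = 1 →
      (E.ReducibleToConstantCoefficients ↔
        ∀ t ∈ E.I,
          deriv (fun s => deriv (fun r => E.β r / E.α r) s / E.α s) t = 0 ∧
          deriv (fun s => E.σ s * E.α s ^ 2 / E.β s ^ 3) t = 0)) :=
  ⟨fun hn => ⟨fun h _ ht => h.deriv_ratios_eq_zero hn ht, E.reducible_of_ratios⟩,
    fun hn => ⟨fun h _ ht => h.deriv_invariants_eq_zero hn ht, E.reducible_of_invariants hn⟩⟩
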